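/- Let $2^{<\omega}$ be the set of finite binary strings, ordered by the initial segment relation $\preceq$, and identify its subsets with subsets of $\omega$ through a fixed computable injective coding of strings by natural numbers. Write $G \cong 2^{<\omega}$ for a set $G \subseteq 2^{<\omega}$ if there is a bijection $i : 2^{<\omega} \to G$ such that $\sigma \preceq \tau$ if and only if $i(\sigma) \preceq i(\tau)$, for all $\sigma, \tau \in 2^{<\omega}$. Let $\mathsf{TT}^1_2$ be the principle that for every coloring $f : 2^{<\omega} \to \{0,1\}$ there is a set $H \subseteq 2^{<\omega}$ with $H \cong 2^{<\omega}$ that is homogeneous for $f$ (that is, $f$ is constant on $H$); its instances are the colorings $f$ and the solutions of $f$ are the sets $H$. A principle admits strong cone avoidance if for every set $Z \subseteq \omega$, every set $C \subseteq \omega$ with $C \not\leq_T Z$, and every (arbitrary, not necessarily computable) instance $I$, there is a solution $S$ of $I$ such that $C \not\leq_T S \oplus Z$. **Theorem.** $\mathsf{TT}^1_2$ admits strong cone avoidance. Equivalently, for every $Z \subseteq \omega$, every $C \subseteq \omega$ with $C \not\leq_T Z$, and every set $A \subseteq 2^{<\omega}$, there is a set $G \cong 2^{<\omega}$ such that $G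 \subseteq A$ or $G \subseteq 2^{<\omega} \setminus A$, and $C \not\leq_T G \oplus Z$. -/

import Mathlib

namespace TreeThm

/-- The characteristic function of a set of natural numbers, as a (total) oracle. -/
noncomputable def charFun (X : Set ℕ) : ℕ →. ℕ :=
  fun n => Part.some (X.indicator (fun _ => 1) n)

/-- Turing reducibility `X ≤_T Y` of sets of natural numbers. -/
def SetTuringLE (X Y : Set ℕ) : Prop :=
  TuringReducible (charFun X) (charFun Y)

/-- The join `X ⊕ Y = {2n : n ∈ X} ∪ {2n + 1 : n ∈ Y}`. -/
def join (X Y : Set ℕ) : Set ℕ :=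
  (fun n => 2 * n) '' X ∪ (fun n => 2 * n + 1) '' Y

/-- The full binary tree `2^{<ω}`, as the set of finite binary strings;
`σ <+: τ` says that `σ` is an initial segment of `τ`. -/
abbrev Str : Type := List Bool

/-- A set of strings as a set of natural numbers, through Mathlib's computable coding of lists. -/
def codes (G : Set Str) : Set ℕ :=
  (fun σ : Str => Encodable.encode σ) '' G

/-- `T ≅ 2^{<ω}`: there is a bijection `i : 2^{<ω} → T` with `σ ≼ τ ↔ i σ ≼ i τ`. -/
def IsoFullTree (T : Set Str) : Prop :=
  ∃ i : Str → Str, Set.BijOn i Set.univ T ∧ ∀ σ τ : Str, σ <+: τ ↔ i σ <+: i τ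

/-- `[T]^n`: the tuples `σ₀ ≺ ⋯ ≺ σₙ₋₁` of elements of `T`. -/
def Chains (T : Set Str) (n : ℕ) : Set (Fin n → Str) :=
  {s | (∀ i, s i ∈ T) ∧ ∀ i j, i < j → s i <+: s j ∧ s i ≠ s j}

/-- The `k`-colorings of `[2^{<ω}]^n`. -/
abbrev Coloring (n k : ℕ) : Type := Chains Set.univ n → Fin k

/-- `Y` is homogeneous for `f`: there is a color `c` with `f([Y]^n) = {c}`. -/
def Homogeneous {n k : ℕ} (f : Coloring n k) (Y : Set Str) : Prop :=
  ∃ c : Fin k, f '' {s | s.1 ∈ Chains Y n} = {c}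

/-- A problem: its instances, and for each instance the sets that are its solutions. -/
structure Principle where
  Inst : Type
  IsSolution : Inst → Set ℕ → Prop

/-- Strong cone avoidance: the instance is arbitrary, not necessarily `Z`-computable. -/
def Principle.AdmitsStrongConeAvoidance (P : Principle) : Prop :=
  ∀ Z C : Set ℕ, ¬ SetTuringLE C Z → ∀ I : P.Inst,
    ∃ S : Set ℕ, P.IsSolution I S ∧ ¬ SetTuringLE C (join S Z)

/-- The tree theorem for `n`-tuples and `k` colors: every coloring `f : [2^{<ω}]^n → k` has an
`f`-homogeneous set `H ⊆ 2^{<ω}` with `H ≅ 2^{<ω}`. -/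
def TT (n k : ℕ) : Principle where
  Inst := Coloring n k
  IsSolution f S := ∃ H : Set Str, S = codes H ∧ Homogeneous f H ∧ IsoFullTree H

end TreeThm

/-! ### Uniform calculus of relations that are `Σ⁰₁` in an oracle -/

namespace TreeThm

open Encodable

variable {ι α β γ : Type*} [Primcodable α] [Primcodable β] [Primcodable γ]

/-! Suppose every homogeneous tree, joined with `Z`, computes `c`. Force with conditions `(X, N,
h)`: `X` computes `Z` but not `c`, `h` is an `X`-computable tree, and the nodes of `h` with index
below `N` are fixed and lie in the chosen color. If every functional could always be defeated by
extending a condition, a generic sequence would produce a tree of that color not computing `c`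
(`exists_generic`). So for the color `A` there is a stuck condition, one with no extension defeating
a certain functional `R`. Repeating this for the complement of `A` inside the cone of `h` above each
of the finitely many leaves `l` of the fixed part gives stuck conditions `(n l, k l)` with
functionals `Q l`, all over one enlarged oracle `X`.

These stuck conditions are incompatible (`not_stuck_of_stuck_leaves`). For an arbitrary set `B` in
place of `A`, let `W B (a, v)` say that some finite extension of `h` with new nodes in `B` makes `R`
output `v` at `a`, or that for some `l` some finite extension of `k l` with new nodes outside `B`
makes `Q l` do so. By compactness, "`W B (a, v)` for all `B`" is `Σ⁰₁` in `X`. It cannot define the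
graph of `c`, so one of two things happens.

If it holds for some `v ≠ c a`, take `B = A`: one of the stuck conditions extends to one forcing a
wrong value. If it fails at some `(a, c a)`, the sets `B` with `¬ W B (a, c a)` form a nonempty
`Π⁰₁` class, which has a member `B` with `B ⊕ X` not computing `c` (`exists_avoiding_member`).
Either some `k l` has no cone inside `B`, and it can be thinned above its fixed part to avoid `B`,
so that `Q l` never outputs `c a` at `a`; or each `k l` has a cone inside `B`, and grafting these
cones onto the leaves of `h` prevents `R` from outputting `c a` at `a`. Both contradict stuckness.
-/

/-- The initial segment of length `n` of an oracle. -/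
def seg (O : ℕ → ℕ) (n : ℕ) : List ℕ := (List.range n).map O

theorem seg_length (O : ℕ → ℕ) (n : ℕ) : (seg O n).length = n := by simp [seg]

theorem seg_take (O : ℕ → ℕ) {m n : ℕ} (h : m ≤ n) : (seg O n).take m = seg O m := by
  simp [seg, ← List.map_take, List.take_range, h]

theorem seg_getElem? (O : ℕ → ℕ) (n i : ℕ) : (seg O n)[i]? = if i < n then some (O i) else none := by
  split_ifs with h <;> simp [seg, h]

theorem primrecRel_exists_lt {R : ℕ → α → Prop} (h : PrimrecRel R) :
    PrimrecRel fun n a => ∃ m < n, R m a :=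
  (h.exists_mem_list.comp (Primrec.list_range.comp Primrec.fst) Primrec.snd).of_eq (by simp)

theorem primrecRel_forall_lt {R : ℕ → α → Prop} (h : PrimrecRel R) :
    PrimrecRel fun n a => ∀ m < n, R m a :=
  (h.forall_mem_list.comp (Primrec.list_range.comp Primrec.fst) Primrec.snd).of_eq (by simp)

theorem seg_congr {O O' : ℕ → ℕ} {n : ℕ} (h : ∀ i < n, O i = O' i) : seg O n = seg O' n := by
  simp only [seg]
  exact List.map_congr_left fun i hi => h i (List.mem_range.1 hi)

/-- `p i a` is `Σ⁰₁` relative to the oracle `O i`, uniformly in `i`. -/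
def Sig (O : ι → ℕ → ℕ) (p : ι → α → Prop) : Prop :=
  ∃ R : α → List ℕ → Prop, PrimrecRel R ∧ ∀ i a, p i a ↔ ∃ n, R a (seg (O i) n)

/-- The graph of `f i` is `Σ⁰₁` relative to the oracle `O i`, uniformly in `i`. -/
def SigF (O : ι → ℕ → ℕ) (f : ι → α → β) : Prop :=
  Sig O fun i (x : α × β) => f i x.1 = x.2

namespace Sig

variable {O : ι → ℕ → ℕ}

/-- Accepting a segment as soon as one of its initial segments is accepted makes acceptance
persistent, so finitely many searches can share one length. -/
theorem exists_mono {p : ι → α → Prop} (h : Sig O p) :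
    ∃ R : α → List ℕ → Prop, PrimrecRel R ∧ (∀ i a, p i a ↔ ∃ n, R a (seg (O i) n)) ∧
      ∀ i a m n, m ≤ n → R a (seg (O i) m) → R a (seg (O i) n) := by
  obtain ⟨R, hR, h⟩ := h
  refine ⟨fun a s => ∃ m < s.length + 1, R a (s.take m), ?_, fun i a => ?_, fun i a m n hmn => ?_⟩
  · have : PrimrecRel fun (m : ℕ) (x : α × List ℕ) => R x.1 (x.2.take m) :=
      hR.comp (Primrec.fst.comp Primrec.snd)
        (Primrec.list_take.comp Primrec.fst (Primrec.snd.comp Primrec.snd))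
    exact (primrecRel_exists_lt this).comp (Primrec.succ.comp (Primrec.list_length.comp Primrec.snd)) Primrec.id
  · rw [h]
    constructor
    · rintro ⟨n, hn⟩
      exact ⟨n, n, by simp [seg_length], by rwa [seg_take _ le_rfl]⟩
    · rintro ⟨n, m, hm, h⟩
      rw [seg_length] at hm
      rw [seg_take _ (by omega)] at h
      exact ⟨m, h⟩
  · rintro ⟨k, hk, h⟩
    rw [seg_length] at hk
    refine ⟨k, by rw [seg_length]; omega, ?_⟩
    rw [seg_take _ (by omega)] at h ⊢
    exact h

theorem of_iff {p q : ι → α → Prop} (h : Sig O p) (H : ∀ i a, q i a ↔ p i a) : Sig O q := by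
  obtain ⟨R, hR, h⟩ := h
  exact ⟨R, hR, fun i a => (H i a).trans (h i a)⟩

theorem prim {p : α → Prop} (h : PrimrecPred p) : Sig O fun _ a => p a :=
  ⟨fun a _ => p a, h.comp Primrec.fst, fun _ _ => ⟨fun h => ⟨0, h⟩, fun ⟨_, h⟩ => h⟩⟩

theorem comp_prim {p : ι → β → Prop} (h : Sig O p) {f : α → β} (hf : Primrec f) :
    Sig O fun i a => p i (f a) := by
  obtain ⟨R, hR, h⟩ := h
  exact ⟨fun a s => R (f a) s, hR.comp (hf.comp Primrec.fst) Primrec.snd, fun i a => h i (f a)⟩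

theorem and {p q : ι → α → Prop} (hp : Sig O p) (hq : Sig O q) :
    Sig O fun i a => p i a ∧ q i a := by
  obtain ⟨R, hR, hp, hRm⟩ := hp.exists_mono
  obtain ⟨S, hS, hq, hSm⟩ := hq.exists_mono
  refine ⟨fun a s => R a s ∧ S a s, PrimrecPred.and hR hS, fun i a => ?_⟩
  simp only [hp, hq]
  constructor
  · rintro ⟨⟨m, hm⟩, n, hn⟩
    exact ⟨max m n, hRm i a _ _ (le_max_left _ _) hm, hSm i a _ _ (le_max_right _ _) hn⟩
  · rintro ⟨n, h, h'⟩
    exact ⟨⟨n, h⟩, n, h'⟩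

theorem or {p q : ι → α → Prop} (hp : Sig O p) (hq : Sig O q) :
    Sig O fun i a => p i a ∨ q i a := by
  obtain ⟨R, hR, hp⟩ := hp
  obtain ⟨S, hS, hq⟩ := hq
  refine ⟨fun a s => R a s ∨ S a s, PrimrecPred.or hR hS, fun i a => ?_⟩
  simp only [hp, hq, exists_or]

theorem ex {p : ι → α → β → Prop} (h : Sig O fun i (x : α × β) => p i x.1 x.2) :
    Sig O fun i a => ∃ b, p i a b := by
  obtain ⟨R, hR, h, hm⟩ := h.exists_mono
  -- The length of the oracle segment also bounds the code of the witness.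
  refine ⟨fun a s => ∃ b ∈ (List.range s.length).filterMap (decode (α := β)), R (a, b) s, ?_,
    fun i a => ?_⟩
  · have h1 : PrimrecRel fun (b : β) (x : α × List ℕ) => R (x.1, b) x.2 :=
      hR.comp (Primrec.pair (Primrec.fst.comp Primrec.snd) Primrec.fst)
        (Primrec.snd.comp Primrec.snd)
    refine h1.exists_mem_list.comp ?_ Primrec.id
    exact Primrec.listFilterMap (Primrec.list_range.comp (Primrec.list_length.comp Primrec.snd))
      (Primrec.decode.comp Primrec.snd)
  · constructor
    · rintro ⟨b, hb⟩
      obtain ⟨n, hn⟩ := (h i (a, b)).1 hb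
      refine ⟨max n (encode b + 1), b, ?_, hm _ _ _ _ (le_max_left _ _) hn⟩
      simp only [List.mem_filterMap, List.mem_range, seg_length]
      exact ⟨encode b, by omega, encodek b⟩
    · rintro ⟨n, b, -, hb⟩
      exact ⟨b, (h i (a, b)).2 ⟨n, hb⟩⟩

theorem ball_lt {p : ι → α → ℕ → Prop} (h : Sig O fun i (x : α × ℕ) => p i x.1 x.2) {k : α → ℕ}
    (hk : Primrec k) : Sig O fun i a => ∀ j < k a, p i a j := by
  obtain ⟨R, hR, h, hm⟩ := h.exists_mono
  refine ⟨fun a s => ∀ j < k a, R (a, j) s, ?_, fun i a => ?_⟩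
  · have h1 : PrimrecRel fun (j : ℕ) (x : α × List ℕ) => R (x.1, j) x.2 :=
      hR.comp (Primrec.pair (Primrec.fst.comp Primrec.snd) Primrec.fst)
        (Primrec.snd.comp Primrec.snd)
    exact (primrecRel_forall_lt h1).comp (hk.comp Primrec.fst) Primrec.id
  · constructor
    · intro H
      have : ∀ j, ∃ n, j < k a → R (a, j) (seg (O i) n) := fun j => by
        by_cases hj : j < k a
        · obtain ⟨n, hn⟩ := (h i (a, j)).1 (H j hj)
          exact ⟨n, fun _ => hn⟩
        · exact ⟨0, fun h => absurd h hj⟩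
      choose f hf using this
      exact ⟨(Finset.range (k a)).sup f, fun j hj =>
        hm _ _ _ _ (Finset.le_sup (Finset.mem_range.2 hj)) (hf j hj)⟩
    · rintro ⟨n, hn⟩ j hj
      exact (h i (a, j)).2 ⟨n, hn j hj⟩

theorem subst {p : ι → β → Prop} (hp : Sig O p) {f : ι → α → β} (hf : SigF O f) :
    Sig O fun i a => p i (f i a) := by
  have : Sig O fun i (a : α) => ∃ b, f i a = b ∧ p i b :=
    ex (Sig.and hf (hp.comp_prim Primrec.snd))
  exact this.of_iff fun i a => by simp

theorem of_false : Sig O fun _ (_ : α) => False :=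
  prim (p := fun _ : α => False) ((Primrec.const false).of_eq (by simp)).primrecPred

theorem of_finite {s : Set α} (hs : s.Finite) : Sig O fun _ a => a ∈ s := by
  induction s, hs using Set.Finite.induction_on with
  | empty => exact of_false
  | @insert b s _ _ ih =>
    exact (or (prim (Primrec.eq.comp Primrec.id (Primrec.const b))) ih).of_iff
      fun _ _ => Set.mem_insert_iff

theorem exists_mem_finite {κ : Type*} {s : Set κ} (hs : s.Finite) {p : κ → ι → α → Prop}
    (hp : ∀ k ∈ s, Sig O (p k)) : Sig O fun i a => ∃ k ∈ s, p k i a := by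
  induction s, hs using Set.Finite.induction_on with
  | empty => exact of_false.of_iff fun i a => by simp
  | @insert b s _ _ ih =>
    exact (or (hp b (Set.mem_insert _ _)) (ih fun k hk => hp k (Set.mem_insert_of_mem _ hk))).of_iff
      fun i a => by simp

theorem oracle : SigF O O := by
  refine ⟨fun x s => s[x.1]? = some x.2, ?_, fun i x => ?_⟩
  · exact Primrec.eq.comp
      (Primrec.list_getElem?.comp Primrec.snd (Primrec.fst.comp Primrec.fst))
      (Primrec.option_some.comp (Primrec.snd.comp Primrec.fst))
  · constructor
    · intro h
      exact ⟨x.1 + 1, by simp [seg_getElem?, h]⟩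
    · rintro ⟨n, hn⟩
      rw [seg_getElem?] at hn
      split_ifs at hn
      simpa using hn

/-- Along a constant map, a fact about one oracle becomes uniform over a family. -/
theorem reindex {κ : Type*} {p : ι → α → Prop} (h : Sig O p) (f : κ → ι) :
    Sig (fun k => O (f k)) fun k a => p (f k) a := by
  obtain ⟨R, hR, h⟩ := h
  exact ⟨R, hR, fun k a => h (f k) a⟩

end Sig

namespace SigF

variable {O : ι → ℕ → ℕ}

theorem prim {f : α → β} (hf : Primrec f) : SigF O fun _ a => f a :=
  Sig.prim (Primrec.eq.comp (hf.comp Primrec.fst) Primrec.snd)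

theorem comp {g : ι → β → γ} (hg : SigF O g) {f : ι → α → β} (hf : SigF O f) :
    SigF O fun i a => g i (f i a) := by
  have : Sig O fun i (x : α × γ) => ∃ b, f i x.1 = b ∧ g i b = x.2 :=
    Sig.ex (Sig.and
      (hf.comp_prim (Primrec.pair (Primrec.fst.comp Primrec.fst) Primrec.snd))
      (hg.comp_prim (Primrec.pair Primrec.snd (Primrec.snd.comp Primrec.fst))))
  exact this.of_iff fun i a => by simp

theorem comp_prim {g : ι → β → γ} (hg : SigF O g) {f : α → β} (hf : Primrec f) :
    SigF O fun i a => g i (f a) :=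
  hg.comp (prim hf)

theorem pair {f : ι → α → β} (hf : SigF O f) {g : ι → α → γ} (hg : SigF O g) :
    SigF O fun i a => (f i a, g i a) := by
  have : Sig O fun i (x : α × β × γ) => f i x.1 = x.2.1 ∧ g i x.1 = x.2.2 :=
    Sig.and
      (Sig.comp_prim hf (Primrec.pair Primrec.fst (Primrec.fst.comp Primrec.snd)))
      (Sig.comp_prim hg (Primrec.pair Primrec.fst (Primrec.snd.comp Primrec.snd)))
  exact this.of_iff fun i a => Prod.ext_iff

theorem prim_comp₂ {δ : Type*} [Primcodable δ] {g : β → γ → δ} (hg : Primrec₂ g)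
    {f : ι → α → β} (hf : SigF O f) {f' : ι → α → γ} (hf' : SigF O f') : SigF O fun i a => g (f i a) (f' i a) :=
  (prim hg).comp (hf.pair hf')

theorem eq {f g : ι → α → β} (hf : SigF O f) (hg : SigF O g) : Sig O fun i a => f i a = g i a :=
  Sig.subst hf ((prim Primrec.id).pair hg)

theorem ne {f g : ι → α → β} (hf : SigF O f) (hg : SigF O g) : Sig O fun i a => f i a ≠ g i a :=
  (Sig.prim (p := fun x : β × β => ¬ x.1 = x.2) (PrimrecPred.not Primrec.eq)).subst (hf.pair hg)

theorem reindex {κ : Type*} {f : ι → α → β} (h : SigF O f) (e : κ → ι) :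
    SigF (fun k => O (e k)) fun k a => f (e k) a :=
  Sig.reindex h e

/-- The initial segments of a computable function are computable. -/
theorem seg {f : ι → ℕ → ℕ} (hf : SigF O f) : SigF O fun i n => TreeThm.seg (f i) n := by
  have : Sig O fun i (x : ℕ × List ℕ) => x.1 = x.2.length ∧
      ∀ j < x.1, f i j = x.2.getD j 0 := by
    refine Sig.and (Sig.prim (Primrec.eq.comp Primrec.fst (Primrec.list_length.comp Primrec.snd))) ?_
    refine Sig.ball_lt ?_ Primrec.fst
    exact Sig.comp_prim hf (Primrec.pair Primrec.snd
      ((Primrec.list_getD 0).comp (Primrec.snd.comp Primrec.fst) Primrec.snd))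
  refine this.of_iff fun i x => ⟨?_, ?_⟩
  · rintro h
    rw [← h, seg_length]
    refine ⟨rfl, fun j hj => ?_⟩
    rw [List.getD_eq_getElem?_getD, seg_getElem?, if_pos hj]
    rfl
  · rintro ⟨h1, h2⟩
    refine List.ext_getElem (by rw [seg_length, h1]) fun j hj hj' => ?_
    rw [seg_length] at hj
    simp only [TreeThm.seg, List.getElem_map, List.getElem_range, h2 j hj]
    simp [hj']

end SigF

namespace Sig

variable {O : ι → ℕ → ℕ}

theorem trans {O' : ι → ℕ → ℕ} {p : ι → α → Prop} (hp : Sig O' p) (h : SigF O O') : Sig O p := by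
  obtain ⟨R, hR, hp⟩ := hp
  have : Sig O fun i (a : α) => ∃ n, R a (seg (O' i) n) :=
    ex ((prim (p := fun x : α × List ℕ => R x.1 x.2) hR).subst
      ((SigF.prim Primrec.fst).pair (h.seg.comp_prim Primrec.snd)))
  exact this.of_iff hp

/-- Closure under recursion along the natural numbers, for relations. -/
theorem nat_rec {p : ι → α → β → Prop} {q : ι → α → ℕ → β → β → Prop}
    (hp : Sig O fun i (x : α × β) => p i x.1 x.2)
    (hq : Sig O fun i (x : α × ℕ × β × β) => q i x.1 x.2.1 x.2.2.1 x.2.2.2) :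
    Sig O fun i (x : α × ℕ × β) =>
      Nat.rec (motive := fun _ => β → Prop) (p i x.1) (fun n r b' => ∃ b, r b ∧ q i x.1 n b b')
        x.2.1 x.2.2 := by
  -- The unbounded witness `L` lists the intermediate values of the recursion, from stage `0` to the
  -- last.
  have key : Sig O fun i (x : α × ℕ × β) => ∃ L : List β,
      (L[x.2.1]? = some x.2.2 ∧ ∃ b, L[0]? = some b ∧ p i x.1 b) ∧
      ∀ j < x.2.1, ∃ b b', (L[j]? = some b ∧ L[j+1]? = some b') ∧ q i x.1 j b b' := by
    have hget {γ : Type _} [Primcodable γ] {f : γ → List β} {n : γ → ℕ} {b : γ → β}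
        (hf : Primrec f) (hn : Primrec n) (hb : Primrec b) :
        PrimrecPred fun x => (f x)[n x]? = some (b x) :=
      Primrec.eq.comp (Primrec.list_getElem?.comp hf hn) (Primrec.option_some.comp hb)
    open Primrec in
    refine ex (and (and (prim ?_) (ex (and (prim ?_) ?_))) ?_)
    · exact hget snd (fst.comp (snd.comp fst)) (snd.comp (snd.comp fst))
    · exact hget (snd.comp fst) (Primrec.const 0) snd
    · exact hp.comp_prim (Primrec.pair (fst.comp (fst.comp fst)) snd)
    · refine ball_lt ?_ (k := fun x : (α × ℕ × β) × List β => x.1.2.1) (fst.comp (snd.comp fst))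
      refine ex ?_
      refine ex ?_
      refine and ?_ ?_
      · exact prim (PrimrecPred.and
          (hget (snd.comp (fst.comp (fst.comp fst))) (snd.comp (fst.comp fst)) (snd.comp fst))
          (hget (snd.comp (fst.comp (fst.comp fst)))
            (Primrec.succ.comp (snd.comp (fst.comp fst))) snd))
      · exact hq.comp_prim (Primrec.pair (fst.comp (fst.comp (fst.comp (fst.comp fst))))
          (Primrec.pair (snd.comp (fst.comp fst)) (Primrec.pair (snd.comp fst) snd)))
  refine key.of_iff ?_
  rintro i ⟨a, n, b⟩
  simp only
  constructor
  · intro h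
    suffices H : ∃ L : List β, L.length = n + 1 ∧ (L[n]? = some b ∧ ∃ b, L[0]? = some b ∧ p i a b) ∧
        ∀ j < n, ∃ b b', (L[j]? = some b ∧ L[j+1]? = some b') ∧ q i a j b b' by
      obtain ⟨L, -, h⟩ := H
      exact ⟨L, h⟩
    induction n generalizing b with
    | zero => exact ⟨[b], rfl, ⟨rfl, b, rfl, h⟩, by simp⟩
    | succ n ih =>
      obtain ⟨b', h1, h2⟩ := h
      obtain ⟨L, hL, ⟨h3, b0, h4, h5⟩, h6⟩ := ih b' h1
      have hlt {j : ℕ} {c b : β} (h : L[j]? = some c) : (L ++ [b])[j]? = some c := by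
        rw [List.getElem?_append_left, h]
        exact (List.getElem?_eq_some_iff.1 h).1
      refine ⟨L ++ [b], by simp [hL], ⟨by rw [← hL]; simp, b0, hlt h4, h5⟩, fun j hj => ?_⟩
      rcases Nat.lt_succ_iff_lt_or_eq.1 hj with hj | rfl
      · obtain ⟨c, c', ⟨h7, h8⟩, h9⟩ := h6 j hj
        exact ⟨c, c', ⟨hlt h7, hlt h8⟩, h9⟩
      · exact ⟨b', b, ⟨hlt h3, by rw [← hL]; simp⟩, h2⟩
  · rintro ⟨L, ⟨h1, b0, h2, h3⟩, h4⟩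
    induction n generalizing b with
    | zero =>
      rw [h2] at h1
      cases h1
      exact h3
    | succ n ih =>
      obtain ⟨c, c', ⟨h7, h8⟩, h9⟩ := h4 n (Nat.lt_succ_self n)
      rw [h8] at h1
      cases h1
      exact ⟨c, ih c (fun j hj => h4 j (hj.trans (Nat.lt_succ_self n))) h7, h9⟩

end Sig

theorem SigF.trans {O O' : ι → ℕ → ℕ} {f : ι → α → β} (hf : SigF O' f) (h : SigF O O') : SigF O f :=
  Sig.trans hf h

/-- Closure of computable functions under primitive recursion. -/
theorem SigF.nat_rec {O : ι → ℕ → ℕ} {f : ι → α → β} {g : ι → α × ℕ × β → β} (hf : SigF O f)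
    (hg : SigF O g) :
    SigF O fun i (x : α × ℕ) =>
      Nat.rec (motive := fun _ => β) (f i x.1) (fun n b => g i (x.1, n, b)) x.2 := by
  have := (Sig.nat_rec (p := fun i a b => f i a = b) (q := fun i a n b b' => g i (a, n, b) = b')
    hf (Sig.comp_prim hg (Primrec.pair (Primrec.pair Primrec.fst (Primrec.pair
      (Primrec.fst.comp Primrec.snd) (Primrec.fst.comp (Primrec.snd.comp Primrec.snd))))
      (Primrec.snd.comp (Primrec.snd.comp Primrec.snd))))).comp_prim
    (f := fun x : (α × ℕ) × β => (x.1.1, x.1.2, x.2))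
    (Primrec.pair (Primrec.fst.comp Primrec.fst) (Primrec.pair (Primrec.snd.comp Primrec.fst) Primrec.snd))
  refine this.of_iff ?_
  rintro i ⟨⟨a, n⟩, b⟩
  simp only
  induction n generalizing b with
  | zero => rfl
  | succ n ih =>
    constructor
    · rintro rfl
      exact ⟨_, (ih _).1 rfl, rfl⟩
    · rintro ⟨b', h1, rfl⟩
      rw [← (ih b').2 h1]

end TreeThm

/-! ### Agreement with Turing reducibility -/

namespace TreeThm

open Encodable

variable {α β γ : Type*} [Primcodable α] [Primcodable β] [Primcodable γ]

/-- The function `f` is computable relative to the oracle `X`. -/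
def CompIn (X : ℕ → ℕ) (f : α → β) : Prop :=
  SigF (fun _ : Unit => X) fun _ => f

/-- The graph of a partial function that is recursive in `X` is `Σ⁰₁` relative to `X`. -/
theorem sig_of_recursiveIn {X : ℕ → ℕ} {f : ℕ →. ℕ}
    (hf : Nat.RecursiveIn {fun n => Part.some (X n)} f) :
    Sig (fun _ : Unit => X) fun _ (x : ℕ × ℕ) => x.2 ∈ f x.1 := by
  induction hf with
  | zero =>
    exact (SigF.prim (Primrec.const 0)).of_iff fun _ x => by
      change x.2 ∈ Part.some 0 ↔ _
      rw [Part.mem_some_iff, eq_comm]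
  | succ => exact (SigF.prim Primrec.succ).of_iff fun _ x => by simp [eq_comm]
  | left =>
    exact (SigF.prim (Primrec.fst.comp Primrec.unpair)).of_iff fun _ x => by simp [eq_comm]
  | right =>
    exact (SigF.prim (Primrec.snd.comp Primrec.unpair)).of_iff fun _ x => by simp [eq_comm]
  | oracle g hg =>
    rw [Set.mem_singleton_iff.1 hg]
    exact (Sig.oracle (O := fun _ : Unit => X)).of_iff fun _ x => by simp [eq_comm]
  | @pair f h _ _ ihf ihh =>
    have : Sig (fun _ : Unit => X) fun _ (x : ℕ × ℕ) =>
        x.2.unpair.1 ∈ f x.1 ∧ x.2.unpair.2 ∈ h x.1 := by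
      have h2 := Primrec.unpair.comp (Primrec.snd (α := ℕ) (β := ℕ))
      exact Sig.and
        (Sig.comp_prim ihf (Primrec.pair Primrec.fst (Primrec.fst.comp h2)))
        (Sig.comp_prim ihh (Primrec.pair Primrec.fst (Primrec.snd.comp h2)))
    refine this.of_iff fun _ x => ?_
    simp only [Seq.seq, Part.map_eq_map, Part.mem_bind_iff, Part.mem_map_iff]
    constructor
    · rintro ⟨_, ⟨a, ha, rfl⟩, b, hb, h3⟩
      rw [← h3]
      simpa using ⟨ha, hb⟩
    · rintro ⟨ha, hb⟩
      exact ⟨_, ⟨_, ha, rfl⟩, _, hb, by simp⟩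
  | @comp f h _ _ ihf ihh =>
    have : Sig (fun _ : Unit => X) fun _ (x : ℕ × ℕ) => ∃ b, b ∈ h x.1 ∧ x.2 ∈ f b :=
      Sig.ex (Sig.and
        (ihh.comp_prim (Primrec.pair (Primrec.fst.comp Primrec.fst) Primrec.snd))
        (ihf.comp_prim (Primrec.pair Primrec.snd (Primrec.snd.comp Primrec.fst))))
    exact this.of_iff fun _ x => Part.mem_bind_iff
  | @prec f h _ _ ihf ihh =>
    have h1 := Sig.nat_rec (O := fun _ : Unit => X) (p := fun _ a b => b ∈ f a)
      (q := fun _ a n b b' => b' ∈ h (Nat.pair a (Nat.pair n b))) ihf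
      (ihh.comp_prim (f := fun x : ℕ × ℕ × ℕ × ℕ => (Nat.pair x.1 (Nat.pair x.2.1 x.2.2.1), x.2.2.2))
        (Primrec.pair (Primrec₂.natPair.comp Primrec.fst (Primrec₂.natPair.comp
          (Primrec.fst.comp Primrec.snd) (Primrec.fst.comp (Primrec.snd.comp Primrec.snd))))
          (Primrec.snd.comp (Primrec.snd.comp Primrec.snd))))
    have h2 := h1.comp_prim (f := fun x : ℕ × ℕ => (x.1.unpair.1, x.1.unpair.2, x.2))
      (Primrec.pair (Primrec.fst.comp (Primrec.unpair.comp Primrec.fst))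
        (Primrec.pair (Primrec.snd.comp (Primrec.unpair.comp Primrec.fst)) Primrec.snd))
    refine h2.of_iff ?_
    rintro _ ⟨x, y⟩
    simp only
    generalize x.unpair.1 = a
    generalize x.unpair.2 = n
    induction n generalizing y with
    | zero => rfl
    | succ n ih =>
      simp only [Part.bind_eq_bind, Part.mem_bind_iff] at ih ⊢
      simp only [ih]
  | @rfind f _ ihf =>
    have : Sig (fun _ : Unit => X) fun _ (x : ℕ × ℕ) => 0 ∈ f (Nat.pair x.1 x.2) ∧
        ∀ j < x.2, ∃ b, b ≠ 0 ∧ b ∈ f (Nat.pair x.1 j) := by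
      refine Sig.and (ihf.comp_prim (Primrec.pair Primrec₂.natPair (Primrec.const 0))) ?_
      refine Sig.ball_lt ?_ Primrec.snd
      refine Sig.ex (Sig.and (Sig.prim ?_) (ihf.comp_prim
        (f := fun x : ((ℕ × ℕ) × ℕ) × ℕ => (Nat.pair x.1.1.1 x.1.2, x.2)) ?_))
      · exact PrimrecPred.not (Primrec.eq.comp Primrec.snd (Primrec.const 0))
      · exact Primrec.pair (Primrec₂.natPair.comp
          (Primrec.fst.comp (Primrec.fst.comp Primrec.fst)) (Primrec.snd.comp Primrec.fst))
          Primrec.snd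
    refine this.of_iff fun _ x => ?_
    refine Nat.mem_rfind.trans ?_
    simp only [Part.map_eq_map, Part.mem_map_iff]
    refine and_congr ?_ (forall_congr' fun j => ?_)
    · simp
    · refine ⟨fun h hj => ?_, fun h hj => ?_⟩
      · obtain ⟨b, hb, hb'⟩ := h hj
        exact ⟨b, by simpa using hb', hb⟩
      · obtain ⟨b, hb, hb'⟩ := h hj
        exact ⟨b, hb', by simpa using hb⟩

namespace RecursiveInTotal

variable {A : Set (ℕ →. ℕ)} {f g : ℕ → ℕ}

theorem comp (hf : Nat.RecursiveIn A fun n => Part.some (f n))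
    (hg : Nat.RecursiveIn A fun n => Part.some (g n)) :
    Nat.RecursiveIn A fun n => Part.some (f (g n)) :=
  (hf.comp hg).of_eq fun n => by simp

theorem pair (hf : Nat.RecursiveIn A fun n => Part.some (f n))
    (hg : Nat.RecursiveIn A fun n => Part.some (g n)) :
    Nat.RecursiveIn A fun n => Part.some (Nat.pair (f n) (g n)) :=
  (hf.pair hg).of_eq fun n => by simp [Seq.seq]

theorem prim {f : α → β} (hf : Primrec f) :
    ∃ F : ℕ → ℕ, Nat.RecursiveIn A (fun n => Part.some (F n)) ∧
      ∀ a, F (encode a) = encode (f a) := by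
  -- The predecessor undoes the shift by one in the code of `some`.
  refine ⟨fun n => (encode ((decode (α := α) n).map f)).pred, ?_, fun a => by simp⟩
  refine Nat.Primrec.recursiveIn (Primrec.nat_iff.1 ?_)
  exact Primrec.pred.comp (Primrec.encode.comp (Primrec.option_map Primrec.decode (hf.comp Primrec.snd)))

end RecursiveInTotal

/-- A total function whose graph is `Σ⁰₁` relative to `X` is recursive in `X`. -/
theorem recursiveIn_of_compIn {X f : ℕ → ℕ} (h : CompIn X f) :
    Nat.RecursiveIn {fun n => Part.some (X n)} fun n => Part.some (f n) := by
  classical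
  set A : Set (ℕ →. ℕ) := {fun n => Part.some (X n)} with hA
  have hX : Nat.RecursiveIn A fun n => Part.some (X n) := .oracle _ rfl
  obtain ⟨R, hR, h⟩ := h
  have hseg : Nat.RecursiveIn A fun n => Part.some (encode (seg X n)) := by
    obtain ⟨F, hF, hF'⟩ := RecursiveInTotal.prim (A := A) (f := fun x : List ℕ × ℕ => x.1 ++ [x.2])
      (Primrec.list_concat.comp Primrec.fst Primrec.snd)
    have h1 : Nat.RecursiveIn A fun p =>
        Part.some (F (Nat.pair p.unpair.2.unpair.2 (X p.unpair.2.unpair.1))) :=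
      RecursiveInTotal.comp hF (RecursiveInTotal.pair
        (RecursiveInTotal.comp Nat.RecursiveIn.right Nat.RecursiveIn.right |>.of_eq fun n => rfl)
        (RecursiveInTotal.comp hX
          (RecursiveInTotal.comp Nat.RecursiveIn.left Nat.RecursiveIn.right |>.of_eq fun n => rfl)))
    have h2 := (Nat.RecursiveIn.prec (Nat.RecursiveIn.zero (O := A)) h1).comp
      (RecursiveInTotal.pair (f := fun _ => 0) (g := fun n => n) Nat.RecursiveIn.zero
        (Nat.Primrec.recursiveIn Nat.Primrec.id))
    refine h2.of_eq fun n => ?_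
    simp only [Part.bind_eq_bind, Part.bind_some, Nat.unpair_pair]
    induction n with
    | zero => rfl
    | succ n ih =>
      simp only [ih, Part.bind_some]
      have : Nat.pair (encode (seg X n)) (X n) = encode (seg X n, X n) := by simp
      rw [this, hF']
      simp [seg, List.range_succ]
  -- `G` vanishes exactly on success, as `rfind` requires; the search below runs over pairs of a
  -- candidate value and a segment length.
  obtain ⟨G, hG, hG'⟩ := RecursiveInTotal.prim (A := A)
    (f := fun x : ℕ × ℕ × List ℕ => if R (x.1, x.2.1) x.2.2 then 0 else 1)
    (Primrec.ite (hR.comp (Primrec.pair Primrec.fst (Primrec.fst.comp Primrec.snd))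
      (Primrec.snd.comp Primrec.snd)) (Primrec.const 0) (Primrec.const 1))
  have hl : Nat.RecursiveIn A fun n => Part.some n.unpair.1 := Nat.RecursiveIn.left
  have hr : Nat.RecursiveIn A fun n => Part.some n.unpair.2 := Nat.RecursiveIn.right
  have h3 : Nat.RecursiveIn A fun p => Part.some (G (Nat.pair p.unpair.1
      (Nat.pair p.unpair.2.unpair.1 (encode (seg X p.unpair.2.unpair.2))))) :=
    RecursiveInTotal.comp hG (RecursiveInTotal.pair hl (RecursiveInTotal.pair
      (RecursiveInTotal.comp hl hr)
      (RecursiveInTotal.comp (f := fun n => encode (seg X n)) hseg (RecursiveInTotal.comp hr hr))))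
  refine (hl.comp h3.rfind).of_eq fun a => ?_
  have hval (w : ℕ) : G (Nat.pair a (Nat.pair w.unpair.1 (encode (seg X w.unpair.2)))) =
      if R (a, w.unpair.1) (seg X w.unpair.2) then 0 else 1 := by
    have : Nat.pair a (Nat.pair w.unpair.1 (encode (seg X w.unpair.2))) =
        encode (a, w.unpair.1, seg X w.unpair.2) := by simp
    rw [this, hG']
    simp
  have h' (b : ℕ) : f a = b ↔ ∃ n, R (a, b) (seg X n) := h () (a, b)
  rw [Part.eq_some_iff]
  simp only [Part.bind_eq_bind, Part.mem_bind_iff, Nat.unpair_pair, hval, Part.map_eq_map,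
    Part.map_some]
  have hex : ∃ w : ℕ, R (a, w.unpair.1) (seg X w.unpair.2) := by
    obtain ⟨n, hn⟩ := (h' (f a)).1 rfl
    exact ⟨Nat.pair (f a) n, by simpa using hn⟩
  refine ⟨Nat.find hex, ?_, ?_⟩
  · refine Nat.mem_rfind.2 ⟨?_, fun {m} hm => ?_⟩
    · simpa using Nat.find_spec hex
    · simpa using Nat.find_min hex hm
  · rw [Part.mem_some_iff]
    exact (h' _).2 ⟨_, Nat.find_spec hex⟩

/-- The characteristic function of a set. -/
noncomputable def chi (C : Set ℕ) : ℕ → ℕ := C.indicator fun _ => 1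

theorem setTuringLE_iff {C D : Set ℕ} : SetTuringLE C D ↔ CompIn (chi D) (chi C) := by
  have : SetTuringLE C D ↔ Nat.RecursiveIn {fun n => Part.some (chi D n)}
      fun n => Part.some (chi C n) := RecursiveIn.iff_nat
  rw [this]
  refine ⟨fun h => (sig_of_recursiveIn h).of_iff fun _ x => ?_, recursiveIn_of_compIn⟩
  simp [eq_comm]

end TreeThm

/-! ### Listing the functionals, and joins of oracles -/

namespace TreeThm

open Encodable

variable {ι α β γ : Type*} [Primcodable α] [Primcodable β] [Primcodable γ]

theorem countable_primrecRel : {R : α → β → Prop | PrimrecRel R}.Countable := by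
  classical
  refine (Set.countable_range fun (k : Nat.Partrec.Code) (a : α) (b : β) =>
    encode (some true) ∈ k.eval (encode (a, b))).mono fun R hR => ?_
  obtain ⟨k, hk⟩ := Nat.Partrec.Code.exists_code.1 (Nat.Partrec.of_primrec hR.decide)
  refine ⟨k, ?_⟩
  funext a b
  change (encode (some true) ∈ k.eval (encode (a, b))) = R a b
  rw [congrFun hk (encode (a, b))]
  by_cases h : R a b <;> simp [h]

/-- Lists all requirements for the two constructions in stages; the listing itself need not be
effective. -/
theorem exists_enum_primrecRel (α β : Type*) [Primcodable α] [Primcodable β] :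
    ∃ R : ℕ → α → β → Prop, (∀ n, PrimrecRel (R n)) ∧ ∀ S, PrimrecRel S → ∃ n, R n = S := by
  have hne : {R : α → β → Prop | PrimrecRel R}.Nonempty :=
    ⟨fun _ _ => True, PrimrecPred.of_eq (Primrec.eq.comp (Primrec.const 0) (Primrec.const 0))
      fun _ => by simp⟩
  obtain ⟨R, hR⟩ := countable_primrecRel.exists_eq_range hne
  exact ⟨R, fun n => (hR ▸ Set.mem_range_self n : R n ∈ {R : α → β → Prop | PrimrecRel R}),
    fun S hS => (hR ▸ hS : S ∈ Set.range R)⟩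

theorem SigF.ite {O : ι → ℕ → ℕ} {f g : ι → α → β} {p : α → Prop} [DecidablePred p]
    (hp : PrimrecPred p) (hf : SigF O f) (hg : SigF O g) :
    SigF O fun i a => if p a then f i a else g i a := by
  have : Sig O fun i (x : α × β) => (p x.1 ∧ f i x.1 = x.2) ∨ (¬ p x.1 ∧ g i x.1 = x.2) :=
    Sig.or (Sig.and (Sig.prim (hp.comp Primrec.fst)) hf)
      (Sig.and (Sig.prim (hp.not.comp Primrec.fst)) hg)
  refine this.of_iff fun i x => ?_
  by_cases h : p x.1 <;> simp [h]

/-- The oracle that interleaves `B` and `X`. -/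
def jn (B X : ℕ → ℕ) (n : ℕ) : ℕ := if n % 2 = 0 then B (n / 2) else X (n / 2)

/-- The initial segment of the interleaved oracle, from initial segments of its parts. -/
def jl (s t : List ℕ) : List ℕ :=
  seg (jn (fun i => s.getD i 0) fun i => t.getD i 0) s.length

theorem seg_getD {X : ℕ → ℕ} {n i : ℕ} (h : i < n) : (seg X n).getD i 0 = X i := by
  rw [List.getD_eq_getElem?_getD, seg_getElem?, if_pos h]
  rfl

theorem jl_seg (B X : ℕ → ℕ) (n : ℕ) : jl (seg B n) (seg X n) = seg (jn B X) n := by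
  rw [jl, seg_length]
  refine seg_congr fun i hi => ?_
  have : i / 2 < n := by omega
  simp only [jn, seg_getD this]

theorem primrec_mod_two : PrimrecPred fun n : ℕ => n % 2 = 0 :=
  Primrec.eq.comp (Primrec.nat_mod.comp Primrec.id (Primrec.const 2)) (Primrec.const 0)

theorem primrec_div_two : Primrec fun n : ℕ => n / 2 :=
  Primrec.nat_div.comp Primrec.id (Primrec.const 2)

theorem primrec_jl : Primrec₂ jl := by
  refine Primrec.list_map (Primrec.list_range.comp (Primrec.list_length.comp Primrec.fst)) ?_
  refine Primrec.ite (primrec_mod_two.comp Primrec.snd) ?_ ?_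
  · exact (Primrec.list_getD 0).comp (Primrec.fst.comp Primrec.fst)
      (primrec_div_two.comp Primrec.snd)
  · exact (Primrec.list_getD 0).comp (Primrec.snd.comp Primrec.fst)
      (primrec_div_two.comp Primrec.snd)

theorem SigF.jn {O B X : ι → ℕ → ℕ} (hB : SigF O B) (hX : SigF O X) :
    SigF O fun i => TreeThm.jn (B i) (X i) :=
  SigF.ite primrec_mod_two (hB.comp_prim primrec_div_two) (hX.comp_prim primrec_div_two)

theorem SigF.jn_left (B X : ι → ℕ → ℕ) : SigF (fun i => TreeThm.jn (B i) (X i)) B := by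
  have h := (Sig.oracle (O := fun i => TreeThm.jn (B i) (X i))).comp_prim Primrec.nat_double
  have : (fun i a => TreeThm.jn (B i) (X i) (2 * a)) = B := by
    funext i a
    simp [TreeThm.jn]
  rwa [this] at h

theorem SigF.jn_right (B X : ι → ℕ → ℕ) : SigF (fun i => TreeThm.jn (B i) (X i)) X := by
  have h := (Sig.oracle (O := fun i => TreeThm.jn (B i) (X i))).comp_prim Primrec.nat_double_succ
  have : (fun i a => TreeThm.jn (B i) (X i) (2 * a + 1)) = X := by
    funext i a
    simp only [TreeThm.jn]
    rw [if_neg (by omega)]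
    congr 1
    omega
  rwa [this] at h

theorem chi_join (C D : Set ℕ) : chi (join C D) = jn (chi C) (chi D) := by
  classical
  funext n
  have hC : n ∈ join C D ↔ (n % 2 = 0 ∧ n / 2 ∈ C) ∨ (n % 2 ≠ 0 ∧ n / 2 ∈ D) := by
    constructor
    · rintro (⟨m, hm, rfl⟩ | ⟨m, hm, rfl⟩)
      · left
        exact ⟨by simp, by simpa using hm⟩
      · right
        refine ⟨by simp, ?_⟩
        have : (2 * m + 1) / 2 = m := by omega
        simpa [this] using hm
    · rintro (⟨h, h'⟩ | ⟨h, h'⟩)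
      · exact Or.inl ⟨_, h', by simp only; omega⟩
      · exact Or.inr ⟨_, h', by simp only; omega⟩
  simp only [chi, jn, Set.indicator, hC]
  by_cases h : n % 2 = 0 <;> simp [h]

/-! ### Compactness of Cantor space and cone avoidance for `Π⁰₁` classes -/

/-- A point of Cantor space, as an oracle. -/
def bits (B : ℕ → Bool) (n : ℕ) : ℕ := (B n).toNat

theorem isOpen_seg (X : ℕ → ℕ) (P : List ℕ → Prop) (n : ℕ) :
    IsOpen {B : ℕ → Bool | P (seg (jn (bits B) X) n)} := by
  let r : (ℕ → Bool) → (Fin n → Bool) := fun B i => B i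
  have hr : Continuous r := continuous_pi fun i => continuous_apply _
  have : {B : ℕ → Bool | P (seg (jn (bits B) X) n)} =
      r ⁻¹' (r '' {B : ℕ → Bool | P (seg (jn (bits B) X) n)}) := by
    refine (Set.subset_preimage_image _ _).antisymm ?_
    rintro B ⟨B', hB', h⟩
    have : seg (jn (bits B') X) n = seg (jn (bits B) X) n := by
      refine seg_congr fun i hi => ?_
      simp only [jn, bits]
      have := congrFun h ⟨i / 2, by omega⟩
      simp only [r] at this
      rw [this]
    simpa only [Set.mem_ofPred_eq, this] using hB'
  rw [this]
  exact (isOpen_discrete _).preimage hr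

theorem Sig.isOpen {X : ℕ → ℕ} {p : (ℕ → Bool) → α → Prop}
    (hp : Sig (fun B => jn (bits B) X) p) (a : α) : IsOpen {B | p B a} := by
  obtain ⟨R, -, h⟩ := hp
  have : {B | p B a} = ⋃ n, {B | R a (seg (jn (bits B) X) n)} := by
    ext B
    simp [h]
  rw [this]
  exact isOpen_iUnion fun n => isOpen_seg X (R a) n

/-- By compactness, if every `B` is accepted at some length then a single length serves all `B`. The
quantifier over `B` thus becomes a bounded one over bit strings of that length. -/
theorem Sig.forall_cantor {X : ℕ → ℕ} {p : (ℕ → Bool) → α → Prop}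
    (hp : Sig (fun B => jn (bits B) X) p) :
    Sig (fun _ : Unit => X) fun _ a => ∀ B, p B a := by
  obtain ⟨R, hR, h, hm⟩ := hp.exists_mono
  -- The binary digits of the numbers `i < 2 ^ N` run through all bit strings of length `N`.
  have key : Sig (fun _ : Unit => X) fun _ (a : α) => ∃ N, ∀ i < 2 ^ N,
      R a (jl (TreeThm.seg (fun j => i / 2 ^ j % 2) N) (TreeThm.seg X N)) := by
    have hpow : Primrec₂ ((· ^ ·) : ℕ → ℕ → ℕ) := Primrec₂.unpaired'.1 Nat.Primrec.pow
    have hb : Primrec₂ fun i N : ℕ => TreeThm.seg (fun j => i / 2 ^ j % 2) N := by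
      refine Primrec.list_map (Primrec.list_range.comp Primrec.snd) ?_
      refine Primrec.nat_mod.comp (Primrec.nat_div.comp (Primrec.fst.comp Primrec.fst)
        (hpow.comp (Primrec.const 2) Primrec.snd)) (Primrec.const 2)
    refine Sig.ex ?_
    refine Sig.ball_lt ?_ (k := fun x : α × ℕ => 2 ^ x.2) (hpow.comp (Primrec.const 2) Primrec.snd)
    refine Sig.subst (f := fun _ (x : (α × ℕ) × ℕ) =>
      (x.1.1, jl (TreeThm.seg (fun j => x.2 / 2 ^ j % 2) x.1.2) (TreeThm.seg X x.1.2)))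
      (Sig.prim (p := fun y : α × List ℕ => R y.1 y.2) hR) ?_
    refine (SigF.prim (Primrec.fst.comp Primrec.fst)).pair
      (SigF.prim_comp₂ primrec_jl
        (SigF.prim (hb.comp Primrec.snd (Primrec.snd.comp Primrec.fst))) ?_)
    exact (Sig.oracle (O := fun _ : Unit => X)).seg.comp_prim (Primrec.snd.comp Primrec.fst)
  refine key.of_iff fun _ a => ?_
  have hbit (B : ℕ → Bool) (i N : ℕ) (hB : ∀ j < N, i.testBit j = B j) :
      jl (TreeThm.seg (fun j => i / 2 ^ j % 2) N) (TreeThm.seg X N) =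
        TreeThm.seg (jn (bits B) X) N := by
    rw [← jl_seg]
    congr 1
    refine seg_congr fun j hj => ?_
    rw [bits, ← hB j hj, Nat.testBit_eq_decide_div_mod_eq]
    rcases Nat.mod_two_eq_zero_or_one (i / 2 ^ j) with h | h <;> simp [h]
  constructor
  · intro H
    have hcov : (Set.univ : Set (ℕ → Bool)) ⊆ ⋃ n, {B | R a (TreeThm.seg (jn (bits B) X) n)} :=
      fun B _ => Set.mem_iUnion.2 ((h B a).1 (H B))
    obtain ⟨N, hN⟩ := isCompact_univ.elim_directed_cover _ (fun n => isOpen_seg X (R a) n) hcov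
      (directed_of_isDirected_le fun m n hmn B hB => hm B a m n hmn hB)
    refine ⟨N, fun i _ => ?_⟩
    rw [hbit (fun j => i.testBit j) i N fun _ _ => rfl]
    exact hN (Set.mem_univ _)
  · rintro ⟨N, hN⟩ B
    refine (h B a).2 ⟨N, ?_⟩
    have := hN (Nat.ofBits fun j : Fin N => B j) (Nat.ofBits_lt_two_pow _)
    rwa [hbit B _ N fun j hj => by simp [Nat.testBit_ofBits_lt, hj]] at this

/-- A nonempty class that is `Π⁰₁` relative to `X` has a member that, joined with `X`, does not
compute a given function not computable from `X`. -/
theorem exists_avoiding_member {X c : ℕ → ℕ} (hc : ¬ CompIn X c) {W : (ℕ → Bool) → Prop}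
    (hW : Sig (fun B => jn (bits B) X) fun B (_ : Unit) => W B) (hne : ∃ B, ¬ W B) :
    ∃ B, ¬ W B ∧ ¬ CompIn (jn (bits B) X) c := by
  have step (W : (ℕ → Bool) → Prop) (hW : Sig (fun B => jn (bits B) X) fun B (_ : Unit) => W B)
      (hne : ∃ B, ¬ W B) (R : ℕ × ℕ → List ℕ → Prop) (hR : PrimrecRel R) :
      ∃ W' : (ℕ → Bool) → Prop, (Sig (fun B => jn (bits B) X) fun B (_ : Unit) => W' B) ∧
        (∃ B, ¬ W' B) ∧ (∀ B, W B → W' B) ∧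
        ∀ B, ¬ W' B → ¬ ∀ x : ℕ × ℕ, c x.1 = x.2 ↔ ∃ n, R x (seg (jn (bits B) X) n) := by
    have hΦ : Sig (fun B => jn (bits B) X) fun B (x : ℕ × ℕ) =>
        ∃ n, R x (seg (jn (bits B) X) n) := ⟨R, hR, fun _ _ => Iff.rfl⟩
    -- Some member of the class fails to output `c x` at `x`: shrink the class to such members.
    by_cases h1 : ∃ x B, ¬ W B ∧ ¬ ∃ n, R (x, c x) (seg (jn (bits B) X) n)
    · obtain ⟨x, B, hB, hB'⟩ := h1
      refine ⟨fun B => W B ∨ ∃ n, R (x, c x) (seg (jn (bits B) X) n),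
        Sig.or hW (hΦ.comp_prim (Primrec.const (x, c x))), ⟨B, by tauto⟩, fun B => Or.inl,
        fun B h h' => h (Or.inr ((h' (x, c x)).1 rfl))⟩
    -- All members output the same wrong value: the class needs no change.
    by_cases h2 : ∃ x v, v ≠ c x ∧ ∀ B, W B ∨ ∃ n, R (x, v) (seg (jn (bits B) X) n)
    · obtain ⟨x, v, hv, h⟩ := h2
      refine ⟨W, hW, hne, fun B => id, fun B hB h' => hv ?_⟩
      exact ((h' (x, v)).2 ((h B).resolve_left hB)).symm
    -- Otherwise `c x = v` exactly when every member of the class outputs `v` at `x`, which by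
    -- compactness is `Σ⁰₁` in `X`.
    · push Not at h1 h2
      refine absurd ?_ hc
      have : Sig (fun B => jn (bits B) X) fun B (x : ℕ × ℕ) =>
          W B ∨ ∃ n, R x (seg (jn (bits B) X) n) :=
        Sig.or (hW.comp_prim (Primrec.const ())) hΦ
      refine this.forall_cantor.of_iff ?_
      rintro _ ⟨x, v⟩
      change c x = v ↔ _
      constructor
      · rintro rfl B
        by_cases hB : W B
        · exact Or.inl hB
        · exact Or.inr (h1 x B hB)
      · intro h
        by_contra hne
        obtain ⟨B, hB, hB'⟩ := h2 x v (Ne.symm hne)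
        rcases h B with h | ⟨n, hn⟩
        · exact hB h
        · exact hB' n hn
  obtain ⟨R, hR, hRs⟩ := exists_enum_primrecRel (ℕ × ℕ) (List ℕ)
  let S := {W : (ℕ → Bool) → Prop //
    (Sig (fun B => jn (bits B) X) fun B (_ : Unit) => W B) ∧ ∃ B, ¬ W B}
  choose next hnext1 hnext2 hnext3 hnext4 using
    fun (n : ℕ) (W : S) => step W.1 W.2.1 W.2.2 (R n) (hR n)
  let V : ℕ → S := fun n =>
    Nat.rec (⟨W, hW, hne⟩ : S) (fun n V => ⟨next n V, hnext1 n V, hnext2 n V⟩) n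
  have hclosed (n : ℕ) : IsClosed {B | ¬ (V n).1 B} :=
    (((V n).2.1.isOpen ()).isClosed_compl)
  obtain ⟨B, hB⟩ := IsCompact.nonempty_iInter_of_sequence_nonempty_isCompact_isClosed
    (fun n => {B | ¬ (V n).1 B}) (fun n B hB hB' => hB (hnext3 n (V n) B hB'))
    (fun n => (V n).2.2) (hclosed 0).isCompact hclosed
  rw [Set.mem_iInter] at hB
  refine ⟨B, hB 0, fun ⟨Q, hQ, h⟩ => ?_⟩
  obtain ⟨n, rfl⟩ := hRs Q hQ
  exact hnext4 n (V n) B (hB (n + 1)) fun x => h () x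

end TreeThm

/-! ### Searches and recursions relative to an oracle; strong embeddings of the full tree -/

namespace TreeThm

open Encodable

variable {α β γ : Type*} [Primcodable α] [Primcodable β] [Primcodable γ]

namespace CompIn

variable {X : ℕ → ℕ}

theorem prim {f : α → β} (hf : Primrec f) : CompIn X f := SigF.prim hf

theorem comp {g : β → γ} (hg : CompIn X g) {f : α → β} (hf : CompIn X f) :
    CompIn X fun a => g (f a) :=
  SigF.comp hg hf

theorem pair {f : α → β} (hf : CompIn X f) {g : α → γ} (hg : CompIn X g) :
    CompIn X fun a => (f a, g a) :=
  SigF.pair hf hg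

theorem trans {f : α → β} (hf : CompIn X f) {Y : ℕ → ℕ} (hX : CompIn Y X) : CompIn Y f :=
  SigF.trans hf hX

theorem refl (X : ℕ → ℕ) : CompIn X X := Sig.oracle

theorem jn {B Z : ℕ → ℕ} (hB : CompIn X B) (hZ : CompIn X Z) : CompIn X (jn B Z) :=
  SigF.jn hB hZ

theorem jn_left (B Z : ℕ → ℕ) : CompIn (TreeThm.jn B Z) B :=
  SigF.jn_left (ι := Unit) (fun _ => B) fun _ => Z

theorem jn_right (B Z : ℕ → ℕ) : CompIn (TreeThm.jn B Z) Z :=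
  SigF.jn_right (ι := Unit) (fun _ => B) fun _ => Z

/-- Unbounded search for a zero. -/
theorem find {g : α × ℕ → ℕ} (hg : CompIn X g) (h : ∀ a, ∃ j, g (a, j) = 0) :
    CompIn X fun a => Nat.find (h a) := by
  have : Sig (fun _ : Unit => X) fun _ (x : α × ℕ) => g x = 0 ∧ ∀ i < x.2, g (x.1, i) ≠ 0 := by
    refine Sig.and (SigF.eq hg (SigF.prim (Primrec.const 0))) ?_
    refine Sig.ball_lt ?_ Primrec.snd
    exact SigF.ne (SigF.comp_prim hg
      (Primrec.pair (Primrec.fst.comp Primrec.fst) Primrec.snd)) (SigF.prim (Primrec.const 0))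
  refine this.of_iff ?_
  rintro _ ⟨a, j⟩
  exact Nat.find_eq_iff (h a)

theorem foldl [Inhabited γ] {g : β × γ → β} (hg : CompIn X g) (b : β) :
    CompIn X fun l : List γ => l.foldl (fun s c => g (s, c)) b := by
  have h1 : CompIn X fun x : List γ × ℕ × β => g (x.2.2, x.1.getD x.2.1 default) := by
    refine hg.comp (pair (prim (Primrec.snd.comp Primrec.snd)) (prim ?_))
    exact (Primrec.list_getD default).comp Primrec.fst (Primrec.fst.comp Primrec.snd)
  have h2 : CompIn X fun x : List γ × ℕ => Nat.rec (motive := fun _ => β) b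
      (fun n s => g (s, x.1.getD n default)) x.2 :=
    SigF.nat_rec (SigF.prim (Primrec.const b)) h1
  have h3 := h2.comp (prim (Primrec.pair Primrec.id (Primrec.list_length (α := γ))))
  have (l : List γ) (n : ℕ) (hn : n ≤ l.length) : Nat.rec (motive := fun _ => β) b
      (fun n s => g (s, l.getD n default)) n = (l.take n).foldl (fun s c => g (s, c)) b := by
    induction n with
    | zero => simp
    | succ n ih =>
      rw [List.take_succ_eq_append_getElem (by omega), List.foldl_append]
      simp only [ih (by omega), List.foldl_cons, List.foldl_nil]
      rw [List.getD_eq_getElem _ _ (by omega)]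
  have h4 : (fun l : List γ => l.foldl (fun s c => g (s, c)) b) = fun l =>
      Nat.rec (motive := fun _ => β) b (fun n s => g (s, l.getD n default)) l.length := by
    funext l
    rw [this l l.length le_rfl, List.take_length]
  rw [h4]
  exact h3

end CompIn

theorem prefix_trichotomy (σ τ : Str) : σ <+: τ ∨ (∃ b, τ ++ [b] <+: σ) ∨
    ∃ ρ b b', b ≠ b' ∧ ρ ++ [b] <+: σ ∧ ρ ++ [b'] <+: τ := by
  induction σ generalizing τ with
  | nil => exact Or.inl (List.nil_prefix)
  | cons a σ ih =>
    cases τ with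
    | nil => exact Or.inr (Or.inl ⟨a, by simp⟩)
    | cons b τ =>
      by_cases hab : a = b
      · subst hab
        rcases ih τ with h | ⟨b, h⟩ | ⟨ρ, b, b', h1, h2, h3⟩
        · exact Or.inl (by simpa using h)
        · exact Or.inr (Or.inl ⟨b, by simpa using h⟩)
        · exact Or.inr (Or.inr ⟨a :: ρ, b, b', h1, by simpa using h2, by simpa using h3⟩)
      · exact Or.inr (Or.inr ⟨[], a, b, hab, by simp, by simp⟩)

theorem eq_of_concat_prefix {ρ τ : Str} {b b' : Bool} (h : ρ ++ [b] <+: τ) (h' : ρ ++ [b'] <+: τ) :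
    b = b' := by
  have := List.IsPrefix.eq_of_length (List.prefix_of_prefix_length_le h h' (by simp)) (by simp)
  simpa using this

/-- Makes the strings with code below `N` a finite set closed under initial segments, that is, a
finite tree. -/
theorem encode_le_of_prefix {σ τ : Str} (h : σ <+: τ) : encode σ ≤ encode τ := by
  induction σ generalizing τ with
  | nil => simp
  | cons a σ ih =>
    obtain ⟨π, rfl⟩ := h
    simp only [List.cons_append, encode_list_cons, Nat.succ_eq_add_one, add_le_add_iff_right]
    have := ih (List.prefix_append σ π)
    rcases this.eq_or_lt with h | h
    · rw [h]
    · exact (Nat.pair_lt_pair_right _ h).le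

/-- A map of strings that sends the two immediate successors of `σ` above the two immediate
successors of the image of `σ`, in the same order. -/
def Strong (h : Str → Str) : Prop :=
  ∀ σ b, h σ ++ [b] <+: h (σ ++ [b])

namespace Strong

variable {h : Str → Str}

theorem id : Strong fun σ => σ := fun _ _ => List.prefix_rfl

theorem mono (hh : Strong h) {σ τ : Str} (hst : σ <+: τ) : h σ <+: h τ := by
  obtain ⟨π, rfl⟩ := hst
  induction π using List.reverseRecOn with
  | nil => simp
  | append_singleton π b ih =>
    rw [← List.append_assoc]
    exact ih.trans ((List.prefix_append _ [b]).trans (hh _ b))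

theorem concat_prefix (hh : Strong h) {σ τ : Str} {b : Bool} (hst : σ ++ [b] <+: τ) :
    h σ ++ [b] <+: h τ :=
  (hh σ b).trans (hh.mono hst)

theorem prefix_iff (hh : Strong h) {σ τ : Str} : h σ <+: h τ ↔ σ <+: τ := by
  refine ⟨fun H => ?_, hh.mono⟩
  rcases prefix_trichotomy σ τ with h1 | ⟨b, h1⟩ | ⟨ρ, b, b', h1, h2, h3⟩
  · exact h1
  · have := ((hh.concat_prefix h1).trans H).length_le
    simp at this
  · exact absurd (eq_of_concat_prefix ((hh.concat_prefix h2).trans H) (hh.concat_prefix h3)) h1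

theorem injective (hh : Strong h) : Function.Injective h := fun σ τ hst => by
  have h1 : σ <+: τ := hh.prefix_iff.1 (hst ▸ List.prefix_rfl)
  have h2 : τ <+: σ := hh.prefix_iff.1 (hst ▸ List.prefix_rfl)
  exact h1.eq_of_length_le h2.length_le

theorem concat_prefix_iff (hh : Strong h) {σ τ : Str} {b : Bool} :
    h σ ++ [b] <+: h τ ↔ σ ++ [b] <+: τ := by
  refine ⟨fun H => ?_, hh.concat_prefix⟩
  obtain ⟨π, rfl⟩ := hh.prefix_iff.1 ((List.prefix_append _ [b]).trans H)
  cases π with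
  | nil =>
    have := H.length_le
    simp at this
  | cons b' π =>
    have h1 : σ ++ [b'] <+: σ ++ b' :: π := by simp
    rw [eq_of_concat_prefix H (hh.concat_prefix h1)]
    exact h1

theorem comp (hh : Strong h) {k : Str → Str} (hk : Strong k) : Strong fun σ => h (k σ) :=
  fun σ b => hh.concat_prefix (hk σ b)

theorem cone (hh : Strong h) (ρ : Str) : Strong fun π => h (ρ ++ π) := fun σ b => by
  change _ <+: h (ρ ++ (σ ++ [b]))
  rw [← List.append_assoc]
  exact hh _ b

theorem isoFullTree (hh : Strong h) : IsoFullTree (Set.range h) :=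
  ⟨h, ⟨fun σ _ => ⟨σ, rfl⟩, hh.injective.injOn, fun _ ⟨σ, hσ⟩ => ⟨σ, trivial, hσ⟩⟩,
    fun _ _ => hh.prefix_iff.symm⟩

theorem length_le (hh : Strong h) (σ : Str) : σ.length ≤ (h σ).length := by
  induction σ using List.reverseRecOn with
  | nil => simp
  | append_singleton σ b ih =>
    have := (hh σ b).length_le
    simp at this ⊢
    omega

/-- A string above the root of a tree but not in it leaves the tree at some immediate successor. -/
theorem notMem_range_iff (hh : Strong h) (y : Str) : y ∉ Set.range h ↔
    ¬ h [] <+: y ∨ ∃ σ b, h σ ++ [b] <+: y ∧ ¬ h (σ ++ [b]) <+: y := by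
  constructor
  · intro hy
    by_contra! H
    obtain ⟨h0, H⟩ := H
    have key (n : ℕ) : ∃ σ : Str, σ.length = n ∧ h σ <+: y := by
      induction n with
      | zero => exact ⟨[], rfl, h0⟩
      | succ n ih =>
        obtain ⟨σ, hσ, π, rfl⟩ := ih
        cases π with
        | nil => exact absurd ⟨σ, by simp⟩ hy
        | cons b π => exact ⟨σ ++ [b], by simp [hσ], H σ b (by simp)⟩
    obtain ⟨σ, hσ, h1⟩ := key (y.length + 1)
    have := hh.length_le σ
    have := h1.length_le
    omega
  · rintro (H | ⟨σ, b, h1, h2⟩) ⟨τ, rfl⟩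
    · exact H (hh.mono List.nil_prefix)
    · exact h2 (hh.mono (hh.concat_prefix_iff.1 h1))

end Strong

/-! ### Trees as oracles, and grafting above a finite part -/

/-- The string with a given code, if there is one. -/
def str (i : ℕ) : Str := (decode₂ Str i).getD []

@[simp]
theorem str_encode (σ : Str) : str (encode σ) = σ := by simp [str]

theorem encode_str_le (i : ℕ) : encode (str i) ≤ i := by
  unfold str
  cases h : decode₂ Str i with
  | none => simp
  | some σ => exact (mem_decode₂.1 h).le

theorem primrec_str : Primrec str := Primrec.option_getD.comp Primrec.decode₂ (Primrec.const [])

/-- A map of strings, as an oracle. -/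
def orc (g : Str → Str) (i : ℕ) : ℕ := encode (g (str i))

theorem seg_orc_congr {g g' : Str → Str} {n : ℕ} (h : ∀ σ : Str, encode σ < n → g σ = g' σ) :
    seg (orc g) n = seg (orc g') n :=
  seg_congr fun i hi => by
    unfold orc
    rw [h _ ((encode_str_le i).trans_lt hi)]

theorem CompIn.orc {X : ℕ → ℕ} {g : Str → Str} (hg : CompIn X g) : CompIn X (orc g) :=
  (CompIn.prim Primrec.encode).comp (hg.comp (CompIn.prim primrec_str))

theorem compIn_orc (g : Str → Str) : CompIn (orc g) g := by
  have := (CompIn.prim primrec_str).comp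
    ((CompIn.refl (orc g)).comp (CompIn.prim (Primrec.encode (α := Str))))
  simpa [TreeThm.orc] using this

theorem finite_encode_lt (N : ℕ) : {σ : Str | encode σ < N}.Finite :=
  (Set.finite_Iio N).preimage encode_injective.injOn

/-- The minimal strings whose code is at least `N`. -/
def Bd (N : ℕ) (μ : Str) : Prop :=
  N ≤ encode μ ∧ ∃ ρ b, μ = ρ ++ [b] ∧ encode ρ < N

theorem finite_bd (N : ℕ) : {μ | Bd N μ}.Finite := by
  refine (((finite_encode_lt N).prod (Set.finite_univ (α := Bool))).image
    fun x : Str × Bool => x.1 ++ [x.2]).subset ?_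
  rintro μ ⟨-, ρ, b, rfl, h⟩
  exact ⟨(ρ, b), ⟨h, trivial⟩, rfl⟩

theorem Bd.eq_of_prefix {N : ℕ} {μ ν : Str} (hμ : Bd N μ) (hν : Bd N ν) (h : μ <+: ν) : μ = ν := by
  obtain ⟨-, ρ, b, rfl, hρ⟩ := hν
  rcases List.prefix_concat_iff.1 h with h | h
  · exact h
  · exact absurd (hμ.1.trans (encode_le_of_prefix h)) (by omega)

/-- `Bd N` is an antichain, so the part of a tree above each leaf can be prescribed independently.
-/
theorem Bd.eq_of_append {N : ℕ} {μ ν π π' : Str} (hμ : Bd N μ) (hν : Bd N ν)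
    (h : μ ++ π = ν ++ π') : μ = ν ∧ π = π' := by
  have : μ = ν := by
    rcases List.prefix_or_prefix_of_prefix (l₃ := μ ++ π) (List.prefix_append μ π)
      (h ▸ List.prefix_append ν π') with h1 | h1
    · exact hμ.eq_of_prefix hν h1
    · exact (hν.eq_of_prefix hμ h1).symm
  subst this
  exact ⟨rfl, List.append_cancel_left h⟩

theorem exists_bd_append {N : ℕ} (hN : 0 < N) {σ : Str} (hσ : N ≤ encode σ) :
    ∃ μ π, Bd N μ ∧ σ = μ ++ π := by
  induction σ using List.reverseRecOn with
  | nil => simp at hσ; omega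
  | append_singleton σ b ih =>
    by_cases h : N ≤ encode σ
    · obtain ⟨μ, π, h1, h2⟩ := ih h
      exact ⟨μ, π ++ [b], h1, by rw [h2, List.append_assoc]⟩
    · exact ⟨σ ++ [b], [], ⟨hσ, σ, b, rfl, by omega⟩, by simp⟩

/-- A finite part of a tree together with trees above its leaves makes up a tree. -/
theorem exists_glue {X : ℕ → ℕ} {N : ℕ} (hN : 0 < N) {t : Str → Str} {f : Str → Str → Str}
    (ht : ∀ (σ : Str) b, encode (σ ++ [b]) < N → t σ ++ [b] <+: t (σ ++ [b]))
    (hf : ∀ μ, Bd N μ → Strong (f μ))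
    (hb : ∀ ρ b, encode ρ < N → Bd N (ρ ++ [b]) → t ρ ++ [b] <+: f (ρ ++ [b]) [])
    (hc : ∀ μ, Bd N μ → CompIn X (f μ)) :
    ∃ h, Strong h ∧ CompIn X h ∧ (∀ σ, encode σ < N → h σ = t σ) ∧
      ∀ μ π, Bd N μ → h (μ ++ π) = f μ π := by
  -- The graph of the glued map: a finite set together with finitely many `X`-computable pieces,
  -- hence `Σ⁰₁` in `X`.
  let P : Str → Str → Prop := fun σ y =>
    (σ, y) ∈ (fun σ => (σ, t σ)) '' {σ : Str | encode σ < N} ∨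
      ∃ μ ∈ {μ | Bd N μ}, ∃ π, μ ++ π = σ ∧ f μ π = y
  have hP : ∀ σ, ∃ y, P σ y := fun σ => by
    by_cases h : encode σ < N
    · exact ⟨t σ, Or.inl ⟨σ, h, rfl⟩⟩
    · obtain ⟨μ, π, hμ, rfl⟩ := exists_bd_append hN (not_lt.1 h)
      exact ⟨f μ π, Or.inr ⟨μ, hμ, π, rfl, rfl⟩⟩
  choose h hh using hP
  have h1 : ∀ σ, encode σ < N → h σ = t σ := fun σ hσ => by
    rcases hh σ with ⟨τ, -, hτ⟩ | ⟨μ, hμ, π, rfl, -⟩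
    · simp only [Prod.mk.injEq] at hτ
      rw [← hτ.2, hτ.1]
    · have := encode_le_of_prefix (List.prefix_append μ π)
      have := hμ.1
      omega
  have h2 : ∀ μ π, Bd N μ → h (μ ++ π) = f μ π := fun μ π hμ => by
    rcases hh (μ ++ π) with ⟨τ, hτ', hτ⟩ | ⟨μ', hμ', π', h3, h4⟩
    · simp only [Prod.mk.injEq] at hτ
      have := encode_le_of_prefix (List.prefix_append μ π)
      have := hμ.1
      rw [hτ.1] at hτ'
      change encode (μ ++ π) < N at hτ'
      omega
    · obtain ⟨rfl, rfl⟩ := Bd.eq_of_append hμ' hμ h3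
      exact h4.symm
  refine ⟨h, fun σ b => ?_, ?_, h1, h2⟩
  · by_cases hσ : encode σ < N
    · rw [h1 σ hσ]
      by_cases hσb : encode (σ ++ [b]) < N
      · rw [h1 _ hσb]
        exact ht σ b hσb
      · have hbd : Bd N (σ ++ [b]) := ⟨not_lt.1 hσb, σ, b, rfl, hσ⟩
        have := h2 (σ ++ [b]) [] hbd
        rw [List.append_nil] at this
        rw [this]
        exact hb σ b hσ hbd
    · obtain ⟨μ, π, hμ, rfl⟩ := exists_bd_append hN (not_lt.1 hσ)
      rw [List.append_assoc, h2 _ _ hμ, h2 _ _ hμ]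
      exact hf μ hμ π b
  · have : Sig (fun _ : Unit => X) fun _ (x : Str × Str) =>
        x ∈ (fun σ => (σ, t σ)) '' {σ : Str | encode σ < N} ∨
          ∃ μ ∈ {μ | Bd N μ}, ∃ π, μ ++ π = x.1 ∧ f μ π = x.2 := by
      refine Sig.or (Sig.of_finite ((finite_encode_lt N).image _)) ?_
      refine Sig.exists_mem_finite (finite_bd N) fun μ hμ => Sig.ex (Sig.and (Sig.prim ?_) ?_)
      · exact Primrec.eq.comp (Primrec.list_append.comp (Primrec.const μ) Primrec.snd)
          (Primrec.fst.comp Primrec.fst)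
      · exact Sig.comp_prim (hc μ hμ) (Primrec.pair Primrec.snd (Primrec.snd.comp Primrec.fst))
    refine this.of_iff ?_
    rintro _ ⟨σ, y⟩
    change h σ = y ↔ _
    refine ⟨fun H => H ▸ hh σ, fun H => ?_⟩
    rcases H with ⟨τ, hτ', hτ⟩ | ⟨μ, hμ, π, h3, h4⟩
    · simp only [Prod.mk.injEq] at hτ
      obtain ⟨rfl, rfl⟩ := hτ
      exact h1 _ hτ'
    · simp only at h3 h4
      rw [← h3, ← h4]
      exact h2 μ π hμ

/-- Either some cone of a tree is contained in `B`, or some subtree computable from the tree and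
`B` is disjoint from `B`. -/
theorem exists_cone_or_subtree {X : ℕ → ℕ} {h : Str → Str} (hX : CompIn X h) {B : ℕ → Bool}
    (hB : CompIn X (bits B)) :
    (∃ σ, ∀ π, B (encode (h (σ ++ π))) = true) ∨
      ∃ k, Strong k ∧ CompIn X k ∧ ∀ σ, B (encode (h (k σ))) = false := by
  by_cases H : ∃ σ, ∀ π, B (encode (h (σ ++ π))) = true
  · exact Or.inl H
  right
  push Not at H
  have hg : CompIn X fun x : Str × ℕ => bits B (encode (h (x.1 ++ str x.2))) :=
    hB.comp ((CompIn.prim Primrec.encode).comp (hX.comp (CompIn.prim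
      (Primrec.list_append.comp Primrec.fst (primrec_str.comp Primrec.snd)))))
  have hex (σ : Str) : ∃ j, bits B (encode (h (σ ++ str j))) = 0 := by
    obtain ⟨π, hπ⟩ := H σ
    exact ⟨encode π, by simpa [bits] using hπ⟩
  let u : Str → Str := fun σ => str (Nat.find (hex σ))
  have hu : CompIn X u := (CompIn.prim primrec_str).comp (hg.find hex)
  have hu' (σ : Str) : B (encode (h (σ ++ u σ))) = false := by
    have : bits B (encode (h (σ ++ u σ))) = 0 := Nat.find_spec (hex σ)
    simpa [bits] using this
  have hconcat : Primrec fun x : Str × Bool => x.1 ++ [x.2] :=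
    Primrec.list_concat.comp Primrec.fst Primrec.snd
  -- The subtree is built along the string: append the next bit, then the extension `u` leading out
  -- of `B`.
  have hk := CompIn.foldl (X := X) (g := fun x : Str × Bool => x.1 ++ [x.2] ++ u (x.1 ++ [x.2]))
    ((CompIn.prim (Primrec.list_append.comp Primrec.fst Primrec.snd)).comp
      ((CompIn.prim hconcat).pair (hu.comp (CompIn.prim hconcat)))) (u [])
  refine ⟨_, fun σ b => ?_, hk, fun σ => ?_⟩
  · simp
  · induction σ using List.reverseRecOn with
    | nil => simpa using hu' []
    | append_singleton σ b ih =>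
      simp only [List.foldl_append, List.foldl_cons, List.foldl_nil]
      exact hu' _

end TreeThm

/-! ### Forcing conditions, the generic tree, and finite extensions -/

namespace TreeThm

open Encodable

/-- The functional given by `R`, with oracles `g` and `Z`, does not compute `c`. -/
def Wrong (c Z : ℕ → ℕ) (R : ℕ × ℕ → List ℕ → Prop) (g : Str → Str) : Prop :=
  ¬ ∀ x : ℕ × ℕ, c x.1 = x.2 ↔ ∃ n, R x (seg (jn (orc g) Z) n)

/-- The oracle `X` computes `Z` but not `c`. -/
def Good (c Z X : ℕ → ℕ) : Prop := CompIn X Z ∧ ¬ CompIn X c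

/-- A forcing condition: a tree computable from `X`, whose nodes with index less than `N` are
in `S`. -/
structure IsCond (S : Set Str) (X : ℕ → ℕ) (N : ℕ) (h : Str → Str) : Prop where
  pos : 0 < N
  strong : Strong h
  comp : CompIn X h
  mem : ∀ σ, encode σ < N → h σ ∈ S

/-- `h'` is a subtree of `h` with the same first `N` nodes, and `N ≤ N'`. -/
structure Ext (N : ℕ) (h : Str → Str) (N' : ℕ) (h' : Str → Str) : Prop where
  le : N ≤ N'
  eq : ∀ σ, encode σ < N → h' σ = h σ
  range : Set.range h' ⊆ Set.range h

theorem Ext.refl (N : ℕ) (h : Str → Str) : Ext N h N h := ⟨le_rfl, fun _ _ => rfl, subset_rfl⟩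

theorem Ext.trans {N N' N'' : ℕ} {h h' h'' : Str → Str} (H : Ext N h N' h')
    (H' : Ext N' h' N'' h'') : Ext N h N'' h'' :=
  ⟨H.le.trans H'.le, fun σ hσ => (H'.eq σ (hσ.trans_le H.le)).trans (H.eq σ hσ),
    H'.range.trans H.range⟩

/-- The condition `(N, h)` forces that the functional given by `R` does not compute `c`. -/
def Forces (c Z : ℕ → ℕ) (N : ℕ) (h : Str → Str) (R : ℕ × ℕ → List ℕ → Prop) : Prop :=
  ∀ g N', Strong g → Ext N h N' g → Wrong c Z R g

theorem Forces.ext {c Z : ℕ → ℕ} {N N' : ℕ} {h h' : Str → Str} {R : ℕ × ℕ → List ℕ → Prop}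
    (H : Forces c Z N h R) (H' : Ext N h N' h') : Forces c Z N' h' R :=
  fun g M hg hM => H g M hg (H'.trans hM)

/-- No extension of the condition `(X, N, h)` forces that the functional given by `R` does not
compute `c`. -/
def Stuck (c Z : ℕ → ℕ) (S : Set Str) (X : ℕ → ℕ) (N : ℕ) (h : Str → Str)
    (R : ℕ × ℕ → List ℕ → Prop) : Prop :=
  ∀ X' N' h', Good c Z X' → CompIn X' X → IsCond S X' N' h' → Ext N h N' h' →
    ¬ Forces c Z N' h' R

theorem IsCond.mono {S : Set Str} {X X' : ℕ → ℕ} {N : ℕ} {h : Str → Str} (H : IsCond S X N h)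
    (hX : CompIn X' X) : IsCond S X' N h :=
  ⟨H.pos, H.strong, H.comp.trans hX, H.mem⟩

theorem Stuck.mono {c Z : ℕ → ℕ} {S : Set Str} {X X' : ℕ → ℕ} {N : ℕ} {h : Str → Str}
    {R : ℕ × ℕ → List ℕ → Prop} (H : Stuck c Z S X N h R) (hX : CompIn X' X) :
    Stuck c Z S X' N h R :=
  fun X'' N' h' hg hX' => H X'' N' h' hg (hX.trans hX')

/-- A finite tree with nodes in the range of `h` extends to a subtree of `h`. -/
theorem exists_extension {X : ℕ → ℕ} {h : Str → Str} (hh : Strong h) (hX : CompIn X h) {M : ℕ}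
    (hM : 0 < M) {g : Str → Str} (hr : ∀ σ, encode σ < M → g σ ∈ Set.range h)
    (hg : ∀ (σ : Str) b, encode (σ ++ [b]) < M → g σ ++ [b] <+: g (σ ++ [b])) :
    ∃ h', Strong h' ∧ CompIn X h' ∧ (∀ σ, encode σ < M → h' σ = g σ) ∧
      Set.range h' ⊆ Set.range h := by
  have : ∀ σ, ∃ τ, encode σ < M → h τ = g σ := fun σ => by
    by_cases hσ : encode σ < M
    · obtain ⟨τ, hτ⟩ := hr σ hσ
      exact ⟨τ, fun _ => hτ⟩
    · exact ⟨[], fun h => absurd h hσ⟩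
  choose s hs using this
  -- Each leaf is `ρ ++ [b]`; above it goes the cone of `h` at the successor in direction `b` of the
  -- node chosen for `ρ`. The default `false` is never used, as leaves are nonempty.
  let f : Str → Str → Str := fun μ ν => h ((s μ.dropLast ++ [μ.getLastD false]) ++ ν)
  obtain ⟨h', h1, h2, h3, h4⟩ := exists_glue (X := X) hM (f := f) hg (fun μ _ => hh.cone _)
    (fun ρ b hρ _ => by
      rw [← hs ρ hρ]
      refine hh.concat_prefix ?_
      simp)
    (fun μ _ => hX.comp (CompIn.prim (Primrec.list_append.comp (Primrec.const _) Primrec.id)))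
  refine ⟨h', h1, h2, h3, ?_⟩
  rintro _ ⟨σ, rfl⟩
  by_cases hσ : encode σ < M
  · rw [h3 σ hσ]
    exact hr σ hσ
  · obtain ⟨μ, π, hμ, rfl⟩ := exists_bd_append hM (not_lt.1 hσ)
    rw [h4 μ π hμ]
    exact ⟨_, rfl⟩

theorem encode_lt_concat (σ : Str) (b : Bool) : encode σ < encode (σ ++ [b]) := by
  refine lt_of_le_of_ne (encode_le_of_prefix (List.prefix_append _ _)) fun h => ?_
  simpa using congrArg List.length (encode_injective h)

/-- Only the node with code `N` has to be moved into `S`, by climbing inside its cone. If `N` codes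
no string, there is nothing to do. -/
theorem IsCond.exists_succ {S : Set Str} {X : ℕ → ℕ} {N : ℕ} {h : Str → Str} (H : IsCond S X N h)
    (hS : ∀ σ, ∃ π, h (σ ++ π) ∈ S) : ∃ h', IsCond S X (N + 1) h' ∧ Ext N h (N + 1) h' := by
  obtain ⟨π, hπ⟩ := hS (str N)
  let g : Str → Str := fun σ => if encode σ < N then h σ else h (σ ++ π)
  obtain ⟨h', h1, h2, h3, h4⟩ := exists_extension H.strong H.comp (M := N + 1) (g := g)
    (Nat.succ_pos N)
    (fun σ _ => by simp only [g]; split_ifs <;> exact ⟨_, rfl⟩)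
    (fun σ b hσ => by
      have hlt := encode_lt_concat σ b
      simp only [g]
      rw [if_pos (by omega)]
      split_ifs
      · exact H.strong σ b
      · exact H.strong.concat_prefix (List.prefix_append _ _))
  refine ⟨h', ⟨Nat.succ_pos N, h1, h2, fun σ hσ => ?_⟩, Nat.le_succ N, fun σ hσ => ?_, h4⟩
  · rw [h3 σ hσ]
    simp only [g]
    split_ifs with h5
    · exact H.mem σ h5
    · have : encode σ = N := by omega
      rw [← this, str_encode] at hπ
      exact hπ
  · rw [h3 σ (by omega)]
    exact if_pos hσ

/-- If no condition is stuck, then there is a tree in `S` that does not compute `c`. -/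
theorem exists_generic {c Z : ℕ → ℕ} {S : Set Str}
    (hS : ∀ X h, Good c Z X → Strong h → CompIn X h → ∃ σ, h σ ∈ S)
    {X₀ : ℕ → ℕ} (hX₀ : Good c Z X₀) {h₀ : Str → Str} (hh₀ : Strong h₀) (hc₀ : CompIn X₀ h₀)
    (hst : ∀ X N h R, Good c Z X → CompIn X X₀ → IsCond S X N h → Set.range h ⊆ Set.range h₀ →
      PrimrecRel R → ¬ Stuck c Z S X N h R) :
    ∃ g, Strong g ∧ Set.range g ⊆ S ∧ ¬ CompIn (jn (orc g) Z) c := by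
  obtain ⟨R, hR, hRs⟩ := exists_enum_primrecRel (ℕ × ℕ) (List ℕ)
  let T := {x : (ℕ → ℕ) × ℕ × (Str → Str) // Good c Z x.1 ∧ CompIn x.1 X₀ ∧
    IsCond S x.1 x.2.1 x.2.2 ∧ Set.range x.2.2 ⊆ Set.range h₀}
  have step (n : ℕ) (x : T) : ∃ y : T, Ext x.1.2.1 x.1.2.2 y.1.2.1 y.1.2.2 ∧
      x.1.2.1 < y.1.2.1 ∧ Forces c Z y.1.2.1 y.1.2.2 (R n) := by
    obtain ⟨⟨X, N, h⟩, hX, hXX, hh, hr⟩ := x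
    have := hst X N h (R n) hX hXX hh hr (hR n)
    simp only [Stuck, not_forall, not_not] at this
    obtain ⟨X', N', h', hX', hXX', hh', hE, hF⟩ := this
    obtain ⟨h'', hh'', hE'⟩ := hh'.exists_succ fun σ =>
      hS X' _ hX' (hh'.strong.cone σ) (hh'.comp.comp (CompIn.prim
        (Primrec.list_append.comp (Primrec.const σ) Primrec.id)))
    have hE'' := hE.trans hE'
    exact ⟨⟨(X', N' + 1, h''), hX', hXX.trans hXX', hh'', hE''.range.trans hr⟩, hE'',
      Nat.lt_succ_of_le hE.le, hF.ext hE'⟩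
  obtain ⟨ρ, hρ⟩ := hS X₀ h₀ hX₀ hh₀ hc₀
  -- The root has code `0`, so only it must lie in `S`.
  have init : IsCond S X₀ 1 fun π => h₀ (ρ ++ π) := by
    refine ⟨one_pos, hh₀.cone ρ, hc₀.comp (CompIn.prim
        (Primrec.list_append.comp (Primrec.const ρ) Primrec.id)), fun σ hσ => ?_⟩
    have : σ = [] := encode_injective (by simpa using hσ)
    simpa [this] using hρ
  choose next hn1 hn2 hn3 using step
  let V : ℕ → T := fun n => Nat.rec
    (⟨(X₀, 1, fun π => h₀ (ρ ++ π)), hX₀, CompIn.refl X₀, init, by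
      rintro _ ⟨π, rfl⟩; exact ⟨_, rfl⟩⟩ : T) (fun n x => next n x) n
  have hV (m n : ℕ) (hmn : m ≤ n) : Ext (V m).1.2.1 (V m).1.2.2 (V n).1.2.1 (V n).1.2.2 := by
    induction n, hmn using Nat.le_induction with
    | base => exact Ext.refl _ _
    | succ n _ ih => exact ih.trans (hn1 n (V n))
  have hN (n : ℕ) : n < (V n).1.2.1 := by
    induction n with
    | zero => exact one_pos
    | succ n ih => exact Nat.lt_of_le_of_lt ih (hn2 n (V n))
  -- The limit tree: by stage `encode σ` the node `σ` is already fixed.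
  let g : Str → Str := fun σ => (V (encode σ)).1.2.2 σ
  have hg (n : ℕ) (σ : Str) (hσ : encode σ < (V n).1.2.1) : g σ = (V n).1.2.2 σ := by
    rcases le_total n (encode σ) with h | h
    · exact (hV _ _ h).eq σ hσ
    · exact ((hV _ _ h).eq σ (hN _)).symm
  have hgs : Strong g := fun σ b => by
    have h1 := hN (encode (σ ++ [b]))
    rw [hg _ _ ((encode_lt_concat σ b).trans h1), hg _ _ h1]
    exact (V _).2.2.2.1.strong σ b
  refine ⟨g, hgs, ?_, fun ⟨Q, hQ, H⟩ => ?_⟩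
  · rintro _ ⟨σ, rfl⟩
    exact (V _).2.2.2.1.mem σ (hN _)
  · obtain ⟨n, rfl⟩ := hRs Q hQ
    refine hn3 n (V n) g _ hgs (Ext.mk le_rfl (hg (n + 1)) ?_) fun x => H () x
    rintro _ ⟨σ, rfl⟩
    rcases le_total (n + 1) (encode σ) with h | h
    · exact (hV _ _ h).range ⟨σ, rfl⟩
    · rw [hg (n + 1) σ (h.trans_lt (hN _))]
      exact ⟨σ, rfl⟩

/-- Some finite tree that extends the first `N` nodes of `h` by nodes of `h` satisfying `P` makes
the functional given by `R` converge to `x.2` at `x.1`. -/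
def Bad (Z : ℕ → ℕ) (h : Str → Str) (N : ℕ) (R : ℕ × ℕ → List ℕ → Prop) (P : Str → Prop)
    (x : ℕ × ℕ) : Prop :=
  ∃ (M n : ℕ) (g : Str → Str), N ≤ M ∧ n ≤ M ∧ (∀ σ : Str, encode σ < M →
    ((encode σ < N → g σ = h σ) ∧ (N ≤ encode σ → P (g σ)) ∧ (∃ τ, h τ = g σ) ∧
      ∀ b, encode (σ ++ [b]) < M → g σ ++ [b] <+: g (σ ++ [b]))) ∧
    R x (seg (jn (orc g) Z) n)

theorem seg_jn_orc_congr {g g' : Str → Str} {n M : ℕ} (Z : ℕ → ℕ) (hn : n ≤ M)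
    (h : ∀ σ : Str, encode σ < M → g σ = g' σ) :
    seg (jn (orc g) Z) n = seg (jn (orc g') Z) n := by
  rw [← jl_seg, ← jl_seg, seg_orc_congr fun σ hσ => h σ (hσ.trans_le hn)]

/-- Extending a finite tree that yields a wrong value to a condition fixing its first `M` nodes
would force that value in every further extension. -/
theorem Stuck.not_bad {c Z : ℕ → ℕ} {S : Set Str} {X : ℕ → ℕ} {N : ℕ} {h : Str → Str}
    {R : ℕ × ℕ → List ℕ → Prop} (H : Stuck c Z S X N h R) (hX : Good c Z X)
    (hh : IsCond S X N h) {a v : ℕ} (hv : v ≠ c a) : ¬ Bad Z h N R (· ∈ S) (a, v) := by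
  rintro ⟨M, n, g, hNM, hnM, hg, hR⟩
  obtain ⟨h', h1, h2, h3, h4⟩ := exists_extension hh.strong hh.comp (hh.pos.trans_le hNM)
    (fun σ hσ => (hg σ hσ).2.2.1)
    (fun σ b hσ => (hg σ ((encode_lt_concat σ b).trans hσ)).2.2.2 b hσ)
  refine H X M h' hX (CompIn.refl X) ⟨hh.pos.trans_le hNM, h1, h2, fun σ hσ => ?_⟩
    ⟨hNM, fun σ hσ => ?_, h4⟩ ?_
  · rw [h3 σ hσ]
    rcases lt_or_ge (encode σ) N with h5 | h5
    · rw [(hg σ hσ).1 h5]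
      exact hh.mem σ h5
    · exact (hg σ hσ).2.1 h5
  · rw [h3 σ (hσ.trans_le hNM)]
    exact (hg σ (hσ.trans_le hNM)).1 hσ
  · intro g' M' hg' hE hW
    refine hv ((hW (a, v)).2 ⟨n, ?_⟩).symm
    rwa [seg_jn_orc_congr Z hnM fun σ hσ => (hE.eq σ hσ).trans (h3 σ hσ)]

/-- A tree below `h'` on which the functional computes `c` outputs `c a` from a finite part, whose
nodes of index at least `N` satisfy `P`; that finite part would witness `Bad`. -/
theorem forces_of_not_bad {c Z : ℕ → ℕ} {N : ℕ} {h h' : Str → Str} {R : ℕ × ℕ → List ℕ → Prop}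
    {P : Str → Prop} {a : ℕ} (H : ¬ Bad Z h N R P (a, c a)) (hE : Ext N h N h')
    (hP : ∀ σ, N ≤ encode σ → P (h' σ)) : Forces c Z N h' R := by
  intro g M hg hE' hW
  obtain ⟨n, hn⟩ := (hW (a, c a)).1 rfl
  refine H ⟨max N n, n, g, le_max_left _ _, le_max_right _ _, fun σ _ =>
    ⟨fun hσ => (hE.trans hE').eq σ hσ, fun hσ => ?_, (hE.trans hE').range ⟨σ, rfl⟩,
      fun b _ => hg σ b⟩, hn⟩
  obtain ⟨τ, hτ⟩ := hE'.range ⟨σ, rfl⟩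
  rw [← hτ]
  -- By injectivity a node of `g` of index at least `N` is not one of the fixed nodes of `h'`.
  refine hP τ (le_of_not_gt fun h => ?_)
  rw [← hE'.eq τ h] at hτ
  rw [hg.injective hτ] at h
  omega

theorem primrecRel_prefix : PrimrecRel fun σ τ : Str => σ <+: τ :=
  (Primrec.eq.comp Primrec.fst (Primrec.list_take.comp
    (Primrec.list_length.comp Primrec.fst) Primrec.snd)).of_eq
    fun _ => List.prefix_iff_eq_take.symm

/-- A finite tree is coded by a list of its nodes, so being `Bad` is an existential search; only the
membership tests consult `B`. -/
theorem sig_bad {Z X : ℕ → ℕ} (hZ : CompIn X Z) {h : Str → Str} (hh : CompIn X h) (N : ℕ)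
    {R : ℕ × ℕ → List ℕ → Prop} (hR : PrimrecRel R) (s : Bool) :
    Sig (fun B => jn (bits B) X) fun B x => Bad Z h N R (fun y => B (encode y) = s) x := by
  set O : (ℕ → Bool) → ℕ → ℕ := fun B => jn (bits B) X
  have hOX : SigF O fun _ => X := SigF.jn_right _ _
  have hOB : SigF O bits := SigF.jn_left _ _
  have hOZ : SigF O fun _ => Z := (hZ.reindex fun _ => ()).trans hOX
  have hOh : SigF O fun _ => h := (hh.reindex fun _ => ()).trans hOX
  let val : List Str → Str → Str := fun t σ => t.getD (encode σ) []
  have hval : Primrec₂ val :=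
    (Primrec.list_getD []).comp Primrec.fst (Primrec.encode.comp Primrec.snd)
  open Primrec in
  -- `w` holds `M`, `n` and the table of nodes. The quantifier over `Bool` is written as one over `b
  -- < 2` to be bounded.
  have key : Sig O fun B (x : ℕ × ℕ) => ∃ w : ℕ × ℕ × List Str,
      ((N ≤ w.1 ∧ w.2.1 ≤ w.1) ∧
      ∀ i < w.1, ((¬ encode (str i) < N ∨ val w.2.2 (str i) = h (str i)) ∧
        (¬ N ≤ encode (str i) ∨ bits B (encode (val w.2.2 (str i))) = s.toNat)) ∧
        (∃ τ, h τ = val w.2.2 (str i)) ∧ ∀ b < 2, ¬ encode (str i ++ [decide (b = 1)]) < w.1 ∨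
          val w.2.2 (str i) ++ [decide (b = 1)] <+: val w.2.2 (str i ++ [decide (b = 1)])) ∧
      R x (jl (seg (orc (val w.2.2)) w.2.1) (seg Z w.2.1)) := by
    refine Sig.ex (Sig.and (Sig.and (Sig.prim ?_) ?_) ?_)
    · exact PrimrecPred.and (nat_le.comp (Primrec.const N) (fst.comp snd))
        (nat_le.comp (fst.comp (snd.comp snd)) (fst.comp snd))
    · refine Sig.ball_lt (k := fun x : (ℕ × ℕ) × ℕ × ℕ × List Str => x.2.1) ?_ (fst.comp snd)
      let Λ := ((ℕ × ℕ) × ℕ × ℕ × List Str) × ℕ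
      have hs : Primrec fun x : Λ => str x.2 := primrec_str.comp snd
      have ht : Primrec fun x : Λ => x.1.2.2.2 := snd.comp (snd.comp (snd.comp fst))
      have hv : Primrec fun x : Λ => val x.1.2.2.2 (str x.2) := hval.comp ht hs
      refine Sig.and (Sig.and (Sig.or (Sig.prim ?_) ?_) (Sig.or (Sig.prim ?_) ?_))
        (Sig.and (Sig.ex ?_) (Sig.prim ?_))
      · exact PrimrecPred.not (nat_lt.comp (Primrec.encode.comp hs) (Primrec.const N))
      · exact SigF.eq (SigF.prim hv) (hOh.comp_prim hs)
      · exact PrimrecPred.not (nat_le.comp (Primrec.const N) (Primrec.encode.comp hs))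
      · exact SigF.eq (hOB.comp_prim (Primrec.encode.comp hv)) (SigF.prim (Primrec.const _))
      · exact SigF.eq (hOh.comp_prim snd) (SigF.prim (hv.comp fst))
      · have hb : Primrec fun x : ℕ × Λ => str x.2.2 ++ [decide (x.1 = 1)] :=
          list_concat.comp (hs.comp snd) (PrimrecPred.decide (Primrec.eq.comp fst (Primrec.const 1)))
        have : PrimrecRel fun (b : ℕ) (x : Λ) => ¬ encode (str x.2 ++ [decide (b = 1)]) < x.1.2.1 ∨
            val x.1.2.2.2 (str x.2) ++ [decide (b = 1)] <+:
              val x.1.2.2.2 (str x.2 ++ [decide (b = 1)]) := by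
          refine PrimrecPred.or (PrimrecPred.not (nat_lt.comp (Primrec.encode.comp hb) ?_))
            (primrecRel_prefix.comp ?_ (hval.comp (ht.comp snd) hb))
          · exact fst.comp (snd.comp (fst.comp snd))
          · exact list_concat.comp (hv.comp snd)
              (PrimrecPred.decide (Primrec.eq.comp fst (Primrec.const 1)))
        exact (primrecRel_forall_lt this).comp (Primrec.const 2) Primrec.id
    · have hseg : Primrec₂ fun (t : List Str) (n : ℕ) => seg (orc (val t)) n :=
        list_map (list_range.comp snd) (Primrec.encode.comp
          (hval.comp (fst.comp fst) (primrec_str.comp snd)))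
      refine Sig.subst (f := fun _ (x : (ℕ × ℕ) × ℕ × ℕ × List Str) =>
        (x.1, jl (seg (orc (val x.2.2.2)) x.2.2.1) (seg Z x.2.2.1)))
        (Sig.prim (p := fun y : (ℕ × ℕ) × List ℕ => R y.1 y.2) hR) ?_
      refine (SigF.prim fst).pair (SigF.prim_comp₂ primrec_jl
        (SigF.prim (hseg.comp (snd.comp (snd.comp snd)) (fst.comp (snd.comp snd)))) ?_)
      exact (SigF.seg hOZ).comp_prim (fst.comp (snd.comp snd))
  refine key.of_iff fun B x => ?_
  have hbits (y : ℕ) : bits B y = s.toNat ↔ B y = s := by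
    unfold bits
    cases B y <;> cases s <;> simp
  have hbool {p : Bool → Prop} : (∀ b < 2, p (decide (b = 1))) ↔ ∀ b, p b := by
    refine ⟨fun H b => ?_, fun H b _ => H _⟩
    cases b
    · exact H 0 (by norm_num)
    · exact H 1 (by norm_num)
  constructor
  · rintro ⟨M, n, g, hN, hn, hg, hR⟩
    have hvg (σ : Str) (hσ : encode σ < M) : val ((List.range M).map fun i => g (str i)) σ = g σ := by
      simp [val, hσ]
    refine ⟨(M, n, (List.range M).map fun i => g (str i)), ⟨⟨hN, hn⟩, ?_⟩, ?_⟩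
    · intro i hi
      have hσ := (encode_str_le i).trans_lt hi
      generalize str i = σ at hσ ⊢
      obtain ⟨h1, h2, h3, h4⟩ := hg σ hσ
      simp only [hvg σ hσ, hbits, ← imp_iff_not_or]
      refine ⟨⟨h1, h2⟩, h3, fun b _ hb => ?_⟩
      rw [hvg _ hb]
      exact h4 _ hb
    · simp only
      rw [jl_seg, seg_jn_orc_congr Z hn hvg]
      exact hR
  · rintro ⟨⟨M, n, t⟩, ⟨⟨hN, hn⟩, H⟩, hR⟩
    simp only at hN hn H hR
    rw [jl_seg] at hR
    refine ⟨M, n, val t, hN, hn, fun σ hσ => ?_, hR⟩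
    have := H (encode σ) hσ
    simp only [str_encode, hbits, ← imp_iff_not_or] at this
    obtain ⟨⟨h1, h2⟩, h3, h4⟩ := this
    exact ⟨h1, h2, h3, hbool.1 h4⟩

end TreeThm

/-! ### Incompatibility of stuck conditions, and the avoiding tree -/

namespace TreeThm

open Encodable

theorem compIn_cone {X : ℕ → ℕ} {h : Str → Str} (hh : CompIn X h) (ρ : Str) :
    CompIn X fun π => h (ρ ++ π) :=
  hh.comp (CompIn.prim (Primrec.list_append.comp (Primrec.const ρ) Primrec.id))

/-- A stuck condition for `A` is incompatible with stuck conditions for the complement of `A` above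
all of its leaves. -/
theorem not_stuck_of_stuck_leaves {c Z X : ℕ → ℕ} {A : Set Str} (hX : Good c Z X) {N : ℕ}
    {h : Str → Str} {R : ℕ × ℕ → List ℕ → Prop} (hR : PrimrecRel R) (hh : IsCond A X N h)
    {n : Str → ℕ} {k : Str → Str → Str} {Q : Str → ℕ × ℕ → List ℕ → Prop}
    (hQ : ∀ l, Bd N l → PrimrecRel (Q l)) (hk : ∀ l, Bd N l → IsCond Aᶜ X (n l) (k l))
    (hkh : ∀ l, Bd N l → Set.range (k l) ⊆ Set.range fun π => h (l ++ π))
    (hst : ∀ l, Bd N l → Stuck c Z Aᶜ X (n l) (k l) (Q l)) : ¬ Stuck c Z A X N h R := by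
  intro hst₀
  let W : (ℕ → Bool) → ℕ × ℕ → Prop := fun B x =>
    Bad Z h N R (fun y => B (encode y) = true) x ∨
      ∃ l ∈ {l | Bd N l}, Bad Z (k l) (n l) (Q l) (fun y => B (encode y) = false) x
  have hW : Sig (fun B => jn (bits B) X) W :=
    Sig.or (sig_bad hX.1 hh.comp N hR true) (Sig.exists_mem_finite (finite_bd N) fun l hl =>
      sig_bad hX.1 (hk l hl).comp (n l) (hQ l hl) false)
  by_cases h1 : ∃ a v, v ≠ c a ∧ ∀ B, W B (a, v)
  · classical
    obtain ⟨a, v, hv, H⟩ := h1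
    have hA (y : Str) : (∃ σ ∈ A, encode σ = encode y) ↔ y ∈ A :=
      ⟨fun ⟨σ, hσ, h⟩ => encode_injective h ▸ hσ, fun hy => ⟨y, hy, rfl⟩⟩
    -- Instantiate `B` with the actual, possibly noncomputable, set `A`.
    rcases H fun i => decide (∃ σ ∈ A, encode σ = i) with H | ⟨l, hl, H⟩
    · refine hst₀.not_bad hX hh hv ?_
      simpa only [decide_eq_true_eq, hA] using H
    · refine (hst l hl).not_bad hX (hk l hl) hv ?_
      simpa only [decide_eq_false_iff_not, hA, Set.mem_compl_iff] using H
  by_cases h2 : ∃ a B, ¬ W B (a, c a)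
  · obtain ⟨a, hB⟩ := h2
    obtain ⟨B, hB, hBc⟩ := exists_avoiding_member hX.2 (W := fun B => W B (a, c a))
      (hW.comp_prim (Primrec.const (a, c a))) hB
    have hBX : CompIn (jn (bits B) X) X := CompIn.jn_right _ _
    have hBB : CompIn (jn (bits B) X) (bits B) := CompIn.jn_left _ _
    have hX' : Good c Z (jn (bits B) X) := ⟨hX.1.trans hBX, hBc⟩
    obtain ⟨hB0, hB1⟩ := not_or.1 hB
    -- Each `k l` has a cone inside `B`; otherwise thinning it above every leaf of its fixed part to
    -- avoid `B` defeats `Q l`.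
    have key : ∀ l, ∃ μ, Bd N l → ∀ π, B (encode (k l (μ ++ π))) = true := by
      intro l
      by_contra! H
      obtain ⟨hl, -⟩ := H []
      replace H := fun μ => (H μ).2
      have hkl := hk l hl
      have hsub (m : Str) := (exists_cone_or_subtree (compIn_cone (hkl.comp.trans hBX) m)
        hBB).resolve_left (by
          rintro ⟨σ, hσ⟩
          obtain ⟨π, hπ⟩ := H (m ++ σ)
          rw [List.append_assoc] at hπ
          exact hπ (hσ π))
      choose u hu1 hu2 hu3 using hsub
      obtain ⟨h', g1, g2, g3, g4⟩ := exists_glue (X := jn (bits B) X) hkl.pos (t := k l)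
        (f := fun m π => k l (m ++ u m π)) (fun σ b _ => hkl.strong σ b)
        (fun m _ => (hkl.strong.cone m).comp (hu1 m))
        (fun ρ b _ _ => hkl.strong.concat_prefix (List.prefix_append _ _))
        (fun m _ => (compIn_cone (hkl.comp.trans hBX) m).comp (hu2 m))
      have hE : Ext (n l) (k l) (n l) h' := by
        refine ⟨le_rfl, g3, ?_⟩
        rintro _ ⟨σ, rfl⟩
        by_cases hσ : encode σ < n l
        · exact ⟨σ, (g3 σ hσ).symm⟩
        · obtain ⟨m, π, hm, rfl⟩ := exists_bd_append hkl.pos (not_lt.1 hσ)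
          exact ⟨_, (g4 m π hm).symm⟩
      refine hst l hl _ (n l) h' hX' hBX ⟨hkl.pos, g1, g2, fun σ hσ => ?_⟩ hE
        (forces_of_not_bad (fun hb => hB1 ⟨l, hl, hb⟩) hE fun σ hσ => ?_)
      · rw [g3 σ hσ]
        exact hkl.mem σ hσ
      · obtain ⟨m, π, hm, rfl⟩ := exists_bd_append hkl.pos hσ
        rw [g4 m π hm]
        exact hu3 m π
    choose μ hμ using key
    -- Graft the cones inside `B` onto the leaves of `h`, so that all nodes from index `N` on lie in
    -- `B`.
    obtain ⟨h', g1, g2, g3, g4⟩ := exists_glue (X := jn (bits B) X) hh.pos (t := h)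
      (f := fun l π => k l (μ l ++ π)) (fun σ b _ => hh.strong σ b)
      (fun l hl => (hk l hl).strong.cone _)
      (fun ρ b _ hl => by
        obtain ⟨π, hπ⟩ := hkh _ hl ⟨μ (ρ ++ [b]) ++ [], rfl⟩
        rw [← hπ]
        exact hh.strong.concat_prefix (List.prefix_append _ _))
      (fun l hl => compIn_cone ((hk l hl).comp.trans hBX) _)
    have hE : Ext N h N h' := by
      refine ⟨le_rfl, g3, ?_⟩
      rintro _ ⟨σ, rfl⟩
      by_cases hσ : encode σ < N
      · exact ⟨σ, (g3 σ hσ).symm⟩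
      · obtain ⟨l, π, hl, rfl⟩ := exists_bd_append hh.pos (not_lt.1 hσ)
        rw [g4 l π hl]
        obtain ⟨τ, hτ⟩ := hkh l hl ⟨μ l ++ π, rfl⟩
        exact ⟨_, hτ⟩
    refine hst₀ _ N h' hX' hBX ⟨hh.pos, g1, g2, fun σ hσ => ?_⟩ hE
      (forces_of_not_bad hB0 hE fun σ hσ => ?_)
    · rw [g3 σ hσ]
      exact hh.mem σ hσ
    · obtain ⟨l, π, hl, rfl⟩ := exists_bd_append hh.pos hσ
      rw [g4 l π hl]
      exact hμ l hl π
  -- Now "`W B (a, v)` for all `B`" defines the graph of `c`, so `X` computes `c`.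
  · push Not at h1 h2
    refine hX.2 (hW.forall_cantor.of_iff ?_)
    rintro _ ⟨a, v⟩
    change c a = v ↔ _
    refine ⟨fun hv B => hv ▸ h2 a B, fun H => ?_⟩
    by_contra hne
    obtain ⟨B, hB⟩ := h1 a v (Ne.symm hne)
    exact hB (H B)

/-- Strong cone avoidance for trees, for functions in place of sets. -/
theorem exists_avoiding_tree {c Z : ℕ → ℕ} (hc : ¬ CompIn Z c) (A : Set Str) :
    ∃ g, Strong g ∧ (Set.range g ⊆ A ∨ Set.range g ⊆ Aᶜ) ∧ ¬ CompIn (jn (orc g) Z) c := by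
  by_contra! H
  have hgood {X : ℕ → ℕ} {h : Str → Str} (hX : Good c Z X) (hh : CompIn X h) :
      ¬ CompIn (jn (orc h) Z) c := fun h' => hX.2 (h'.trans (hh.orc.jn hX.1))
  -- A tree missing `A` is homogeneous, so by assumption it computes `c` together with `Z`, and then
  -- so does `X`.
  have hA0 : ∀ X h, Good c Z X → Strong h → CompIn X h → ∃ σ, h σ ∈ A := by
    intro X h hX hh hc
    by_contra! hA
    exact hgood hX hc (H h hh (Or.inr (by rintro _ ⟨σ, rfl⟩; exact hA σ)))
  have hA1 : ∀ X h, Good c Z X → Strong h → CompIn X h → ∃ σ, h σ ∈ Aᶜ := by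
    intro X h hX hh hc
    by_contra! hA
    exact hgood hX hc (H h hh (Or.inl (by rintro _ ⟨σ, rfl⟩; exact not_not.1 (hA σ))))
  have hZ : Good c Z Z := ⟨CompIn.refl Z, hc⟩
  have hst0 : ∃ X N h R, Good c Z X ∧ IsCond A X N h ∧ PrimrecRel R ∧ Stuck c Z A X N h R := by
    by_contra! hst
    obtain ⟨g, hg, hgA, hgc⟩ := exists_generic hA0 hZ Strong.id (CompIn.prim Primrec.id)
      fun X N h R hX _ hh _ hR => hst X N h R hX hh hR
    exact hgc (H g hg (Or.inl hgA))
  obtain ⟨X, N, h, R, hX, hh, hR, hst⟩ := hst0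
  -- The leaves are treated one at a time with a growing oracle; earlier stuck conditions stay stuck
  -- by `Stuck.mono`. A common oracle is needed to choose a single `B`.
  have leaves : ∃ X', Good c Z X' ∧ CompIn X' X ∧ ∀ l ∈ {l | Bd N l}, ∃ n k Q, PrimrecRel Q ∧
      IsCond Aᶜ X' n k ∧ (Set.range k ⊆ Set.range fun π => h (l ++ π)) ∧
        Stuck c Z Aᶜ X' n k Q := by
    induction {l | Bd N l}, finite_bd N using Set.Finite.induction_on with
    | empty => exact ⟨X, hX, CompIn.refl X, by simp⟩
    | @insert l s _ _ ih =>
      obtain ⟨X', hX', hXX', hs⟩ := ih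
      have hl : ∃ X'' n k Q, Good c Z X'' ∧ CompIn X'' X' ∧ PrimrecRel Q ∧ IsCond Aᶜ X'' n k ∧
          (Set.range k ⊆ Set.range fun π => h (l ++ π)) ∧ Stuck c Z Aᶜ X'' n k Q := by
        by_contra! hst
        obtain ⟨g, hg, hgA, hgc⟩ := exists_generic hA1 hX' (hh.strong.cone l)
          (compIn_cone (hh.comp.trans hXX') l)
          fun X'' n k Q hX'' hXX hk hr hQ => hst X'' n k Q hX'' hXX hQ hk hr
        exact hgc (H g hg (Or.inr hgA))
      obtain ⟨X'', n, k, Q, hX'', hXX'', hQ, hk, hr, hst'⟩ := hl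
      refine ⟨X'', hX'', hXX'.trans hXX'', fun m hm => ?_⟩
      rcases Set.mem_insert_iff.1 hm with rfl | hm
      · exact ⟨n, k, Q, hQ, hk, hr, hst'⟩
      · obtain ⟨n, k, Q, hQ, hk, hr, hst'⟩ := hs m hm
        exact ⟨n, k, Q, hQ, hk.mono hXX'', hr, hst'.mono hXX''⟩
  obtain ⟨X', hX', hXX', hl⟩ := leaves
  have hl' : ∀ l, ∃ n k Q, Bd N l → PrimrecRel Q ∧
      IsCond Aᶜ X' n k ∧ (Set.range k ⊆ Set.range fun π => h (l ++ π)) ∧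
        Stuck c Z Aᶜ X' n k Q := fun l => by
    by_cases hbd : Bd N l
    · obtain ⟨n, k, Q, hq⟩ := hl l hbd
      exact ⟨n, k, Q, fun _ => hq⟩
    · exact ⟨0, fun σ => σ, fun _ _ => True, fun h => absurd h hbd⟩
  choose n k Q hq using hl'
  exact not_stuck_of_stuck_leaves hX' hR (hh.mono hXX') (fun l hl => (hq l hl).1)
    (fun l hl => (hq l hl).2.1) (fun l hl => (hq l hl).2.2.1) (fun l hl => (hq l hl).2.2.2)
    (hst.mono hXX')

/-! ### From maps to their sets of nodes -/

/-- The set of nodes of a tree is computable from the tree. -/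
theorem compIn_codes_range {g : Str → Str} (hg : Strong g) :
    CompIn (orc g) (chi (codes (Set.range g))) := by
  classical
  set O : Unit → ℕ → ℕ := fun _ => orc g
  have hO : SigF O fun _ => g := compIn_orc g
  open Primrec in
  -- Both membership and nonmembership are `Σ⁰₁` in the map, the latter by
  -- `Strong.notMem_range_iff`.
  have key : Sig O fun _ (x : ℕ × ℕ) => ((∃ σ, g σ = str x.1) ∧ (encode (str x.1) = x.1 ∧ 1 = x.2)) ∨
      ((encode (str x.1) ≠ x.1 ∨ (¬ g [] <+: str x.1 ∨ ∃ y : Str × Bool, g y.1 ++ [y.2] <+: str x.1 ∧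
        ¬ g (y.1 ++ [y.2]) <+: str x.1)) ∧ 0 = x.2) := by
    have hs : Primrec fun x : ℕ × ℕ => str x.1 := primrec_str.comp fst
    refine Sig.or (Sig.and (Sig.ex ?_) (Sig.prim ?_))
      (Sig.and (Sig.or (Sig.prim ?_) (Sig.or (Sig.prim ?_) (Sig.ex (Sig.and ?_ ?_)))) (Sig.prim ?_))
    · exact SigF.eq (hO.comp_prim snd) (SigF.prim (hs.comp fst))
    · exact PrimrecPred.and (Primrec.eq.comp (Primrec.encode.comp hs) fst)
        (Primrec.eq.comp (Primrec.const 1) snd)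
    · exact PrimrecPred.not (Primrec.eq.comp (Primrec.encode.comp hs) fst)
    · exact PrimrecPred.not (primrecRel_prefix.comp (Primrec.const _) hs)
    · exact (Sig.prim (p := fun y : Str × Str => y.1 <+: y.2) primrecRel_prefix).subst
        ((SigF.prim_comp₂ list_concat (hO.comp_prim (fst.comp snd))
          (SigF.prim (snd.comp snd))).pair (SigF.prim (hs.comp fst)))
    · exact (Sig.prim (p := fun y : Str × Str => ¬ y.1 <+: y.2)
        (PrimrecPred.not primrecRel_prefix)).subst
        ((hO.comp_prim (list_concat.comp (fst.comp snd) (snd.comp snd))).pair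
          (SigF.prim (hs.comp fst)))
    · exact Primrec.eq.comp (Primrec.const 0) snd
  refine key.of_iff ?_
  rintro _ ⟨i, v⟩
  change chi (codes (Set.range g)) i = v ↔ _
  simp only [Prod.exists, ← hg.notMem_range_iff]
  have hi : i ∈ codes (Set.range g) ↔ encode (str i) = i ∧ str i ∈ Set.range g := by
    constructor
    · rintro ⟨σ, hσ, rfl⟩
      simpa using hσ
    · rintro ⟨h1, h2⟩
      exact ⟨_, h2, h1⟩
  have hr : (∃ σ, g σ = str i) ↔ str i ∈ Set.range g := Iff.rfl
  simp only [hr, chi, Set.indicator, hi]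
  by_cases h1 : encode (str i) = i <;> by_cases h2 : str i ∈ Set.range g <;> simp [h1, h2]

theorem exists_avoiding_isoFullTree {Z C : Set ℕ} (hC : ¬ SetTuringLE C Z) (A : Set Str) :
    ∃ G : Set Str, IsoFullTree G ∧ (G ⊆ A ∨ G ⊆ Aᶜ) ∧ ¬ SetTuringLE C (join (codes G) Z) := by
  rw [setTuringLE_iff] at hC
  obtain ⟨g, hg, hA, hc⟩ := exists_avoiding_tree hC A
  refine ⟨Set.range g, hg.isoFullTree, hA, fun h => hc ?_⟩
  rw [setTuringLE_iff, chi_join] at h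
  exact h.trans (((compIn_codes_range hg).trans (CompIn.jn_left _ _)).jn (CompIn.jn_right _ _))

end TreeThm

theorem mainTheorem4 :
    (TreeThm.TT 1 2).AdmitsStrongConeAvoidance ∧
    ∀ (Z C : Set ℕ), ¬ TreeThm.SetTuringLE C Z → ∀ A : Set TreeThm.Str,
      ∃ G : Set TreeThm.Str, TreeThm.IsoFullTree G ∧ (G ⊆ A ∨ G ⊆ Aᶜ) ∧
        ¬ TreeThm.SetTuringLE C (TreeThm.join (TreeThm.codes G) Z) := by
  refine ⟨fun Z C hC f => ?_, fun Z C hC A => TreeThm.exists_avoiding_isoFullTree hC A⟩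
  have hmem (σ : TreeThm.Str) : (fun _ : Fin 1 => σ) ∈ TreeThm.Chains Set.univ 1 :=
    ⟨fun _ => trivial, fun i j hij => by omega⟩
  change TreeThm.Coloring 1 2 at f
  obtain ⟨G, hG, hA, hc⟩ := TreeThm.exists_avoiding_isoFullTree hC
    {σ | f ⟨fun _ => σ, hmem σ⟩ = 0}
  refine ⟨TreeThm.codes G, ⟨G, rfl, ?_, hG⟩, hc⟩
  obtain ⟨i, hi, -⟩ := hG
  have hconst (k : Fin 2) (hk : ∀ σ ∈ G, f ⟨fun _ => σ, hmem σ⟩ = k) :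
      TreeThm.Homogeneous f G := by
    -- The image must equal `{k}`, so a point of `G` has to be exhibited: the image of the root.
    refine ⟨k, Set.eq_singleton_iff_unique_mem.2 ⟨⟨⟨fun _ => i [], hmem _⟩, ?_, ?_⟩, ?_⟩⟩
    · exact ⟨fun _ => hi.1 trivial, fun i j hij => by omega⟩
    · exact hk _ (hi.1 trivial)
    · rintro _ ⟨⟨s, hs⟩, hsG, rfl⟩
      have : s = fun _ => s 0 := funext fun j => by rw [Subsingleton.elim j 0]
      have h0 := hk (s 0) (hsG.1 0)
      have h1 : (⟨s, hs⟩ : TreeThm.Chains Set.univ 1) = ⟨fun _ => s 0, hmem _⟩ := Subtype.ext this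
      rw [h1]
      exact h0
  rcases hA with hA | hA
  · exact hconst 0 fun σ hσ => hA hσ
  · refine hconst 1 fun σ hσ => ?_
    have : f ⟨fun _ => σ, hmem σ⟩ ≠ 0 := hA hσ
    omega
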